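/- Let $K$ be an algebraically closed field of characteristic zero. All superalgebras are finite-dimensional associative superalgebras $A=A_{\bar 0}\oplus A_{\bar 1}$ over $K$ (possibly without unit). An odd-symmetric superalgebra is a pair $(A,B)$ with $B$ a bilinear form on $A$ that is odd ($B(A_{\bar 0},A_{\bar 0})=B(A_{\bar 1},A_{\bar 1})=0$), supersymmetric ($B(x,y)=(-1)^{|x||y|}B(y,x)$ for homogeneous $x,y$), associative ($B(xy,z)=B(x,yz)$) and non-degenerate. It is $B$-irreducible if $0$ and $A$ are its only graded two-sided ideals on which $B$ restricts to a non-degenerate form. A superalgebra is simple if its product is not null and $0$ and $A$ are its only graded two-sided ideals. $M_{r,s}(K)$ is the algebra of square matrices of order $r+s$, with block-diagonal matrices even and block-off-diagonal matrices odd (blocks of sizes $r$ and $s$). $Q_n(K)$ is its subsuperalgebra, for $r=s=n$, of the matrices $\begin{pmatrix}a&b\\ b&a\end{pmatrix}$ with $a,b\in M_n(K)$. **Generalized double extension.** Let $(W,*,B_W)$ be an odd-symmetric superalgebra and $(V,\star)$ a superalgebra. Let $P(V^*)$ be the dual space of $V$ with reversed parity: $P(V^*)_{\bar 0}=(V^*)_{\bar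 1}$ and $P(V^*)_{\bar 1}=(V^*)_{\bar 0}$. A context consists of an even linear map $\mu:V\to\mathrm{End}(W)$ and even bilinear maps $\lambda:V\times V\to W$ and $\gamma:V\times V\to P(V^*)$ such that, for all $v,v',v'',v'''\in V$ and $x,y\in W$, with $\mu(v)^*$ the adjoint of $\mu(v)$ for $B_W$ (that is, $B_W(\mu(v)x,y)=B_W(x,\mu(v)^*y)$), 1. $\mu(v)(x*y)=\mu(v)(x)*y$; 2. $\mu(v)\circ\mu(v')^*=\mu(v')^*\circ\mu(v)$; 3. $\mu(v)(\mu(v')(x))=\lambda(v,v')*x+\mu(v\star v')(x)$; 4. $\lambda(v,v'\star v'')+\mu(v)(\lambda(v',v''))=\mu(v'')^*(\lambda(v,v'))+\lambda(v\star v',v'')$; 5. $\gamma(v,v')(v'')=\gamma(v',v'')(v)$; 6. $\gamma(v\star v',v'')(v''')+\gamma(v,v')(v''\star v''')-\gamma(v,v'\star v'')(v''')-\gamma(v',v'')(v'''\star v)=B_W(\lambda(v''',v),\lambda(v',v''))-B_W(\lambda(v,v'),\lambda(v'',v'''))$. The generalized double extension of $(W,B_W)$ by $V$ by means of $(\mu,\lambda,\gamma)$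 is the graded space $P(V^*)\oplus W\oplus V$ with the form $\tilde B(f+x+v,\,g+y+v')=B_W(x,y)+f(v')+g(v)$ and the product $$(f+x+v)(g+y+v')=\big[\gamma(v,v')+\nu(v,y)+g\circ R_v+\nu'(x,v')+f\circ L_{v'}+\psi(x,y)\big]+\big[\lambda(v,v')+\mu(v)(y)+\mu(v')^*(x)+x*y\big]+v\star v',$$ where $R_v(w)=w\star v$, $L_{v'}(w)=v'\star w$, $\nu(v,x)(w)=B_W(x,\lambda(w,v))$, $\nu'(x,v)(w)=B_W(x,\lambda(v,w))$ and $\psi(x,y)(w)=B_W(\mu(w)(x),y)$ for $w\in V$. **Proposition.** Let $(A,B)$ be a nonzero, $B$-irreducible, non-simple odd-symmetric superalgebra. Then $(A,B)$ is isomorphic, by an even isomorphism of algebras that carries $B$ to $\tilde B$, to a generalized double extension of some odd-symmetric superalgebra $(W,B_W)$ (where $W=0$ is allowed) by a superalgebra $V$ which is one of: $M_{r,s}(K)$ with $r\ge 1$, $s\ge 0$; $Q_n(K)$ with $n\ge 1$; or a one-dimensional superalgebra (even or odd) with null product. -/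

import Mathlib

/-- The structure of an associative superalgebra on a `K`-vector space `A`: an associative
bilinear product and a decomposition `A = A₀ ⊕ A₁` with `A_i A_j ⊆ A_{i+j}`, `i, j ∈ ℤ/2`. -/
structure AssocSuperalgebra (K : Type*) (A : Type*) [Field K] [AddCommGroup A] [Module K A] where
  mul : A →ₗ[K] A →ₗ[K] A
  mul_assoc : ∀ x y z, mul (mul x y) z = mul x (mul y z)
  grade : ZMod 2 → Submodule K A
  isCompl : IsCompl (grade 0) (grade 1)
  mul_mem : ∀ i j x y, x ∈ grade i → y ∈ grade j → mul x y ∈ grade (i + j)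

namespace AssocSuperalgebra

section Basic

variable {K A : Type*} [Field K] [AddCommGroup A] [Module K A]

/-- `B` is an odd-symmetric structure on the superalgebra `S`: an odd, supersymmetric, associative
and non-degenerate bilinear form. -/
structure IsOddSymmetric (S : AssocSuperalgebra K A) (B : LinearMap.BilinForm K A) : Prop where
  odd : ∀ i j x y, x ∈ S.grade i → y ∈ S.grade j → i + j + 1 ≠ 0 → B x y = 0
  supersymm : ∀ i j x y, x ∈ S.grade i → y ∈ S.grade j →
    B x y = (-1) ^ (i.val * j.val) * B y x
  assoc : ∀ x y z, B (S.mul x y) z = B x (S.mul y z)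
  nondegenerate : B.Nondegenerate

/-- A graded two-sided ideal: a subspace `I` with `A I ⊆ I`, `I A ⊆ I` and
`I = (I ∩ A₀) + (I ∩ A₁)`. -/
structure IsGradedIdeal (S : AssocSuperalgebra K A) (I : Submodule K A) : Prop where
  mul_mem_left : ∀ a x, x ∈ I → S.mul a x ∈ I
  mul_mem_right : ∀ x a, x ∈ I → S.mul x a ∈ I
  graded : I = (I ⊓ S.grade 0) ⊔ (I ⊓ S.grade 1)

/-- `(A, B)` is `B`-irreducible: the only graded two-sided ideals of `A` on which `B` restricts
to a non-degenerate form are `0` and `A`. -/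
def IsBIrreducible (S : AssocSuperalgebra K A) (B : LinearMap.BilinForm K A) : Prop :=
  ∀ I : Submodule K A, S.IsGradedIdeal I → (B.restrict I).Nondegenerate → I = ⊥ ∨ I = ⊤

/-- A simple superalgebra: the product is not null and there is no graded two-sided ideal other
than `0` and `A`. -/
def IsSimple (S : AssocSuperalgebra K A) : Prop :=
  (∃ x y, S.mul x y ≠ 0) ∧ ∀ I : Submodule K A, S.IsGradedIdeal I → I = ⊥ ∨ I = ⊤

/-- A linear bijection that is an isomorphism of superalgebras with bilinear form: it preserves
the product, the grading and the form. -/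
structure IsIsometricIso {A' : Type*} [AddCommGroup A'] [Module K A']
    (S : AssocSuperalgebra K A) (B : LinearMap.BilinForm K A)
    (S' : AssocSuperalgebra K A') (B' : LinearMap.BilinForm K A') (e : A ≃ₗ[K] A') : Prop where
  map_mul : ∀ x y, e (S.mul x y) = S'.mul (e x) (e y)
  map_grade : ∀ i x, x ∈ S.grade i ↔ e x ∈ S'.grade i
  map_form : ∀ x y, B' (e x) (e y) = B x y

theorem exists_add (S : AssocSuperalgebra K A) (x : A) :
    ∃ x₀ ∈ S.grade 0, ∃ x₁ ∈ S.grade 1, x₀ + x₁ = x :=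
  Submodule.mem_sup.1 (S.isCompl.sup_eq_top ▸ Submodule.mem_top)

theorem eq_zero_of_mem (S : AssocSuperalgebra K A) {x : A} (h₀ : x ∈ S.grade 0)
    (h₁ : x ∈ S.grade 1) : x = 0 :=
  Submodule.disjoint_def.1 S.isCompl.disjoint x h₀ h₁

/-- An odd supersymmetric form is symmetric. -/
theorem IsOddSymmetric.symm {S : AssocSuperalgebra K A} {B : LinearMap.BilinForm K A}
    (h : S.IsOddSymmetric B) (x y : A) : B x y = B y x := by
  obtain ⟨x₀, hx₀, x₁, hx₁, rfl⟩ := S.exists_add x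
  obtain ⟨y₀, hy₀, y₁, hy₁, rfl⟩ := S.exists_add y
  have h00 := h.supersymm 0 0 _ _ hx₀ hy₀
  have h01 := h.supersymm 0 1 _ _ hx₀ hy₁
  have h10 := h.supersymm 1 0 _ _ hx₁ hy₀
  have e1 := h.odd 1 1 _ _ hx₁ hy₁ (by decide)
  have e2 := h.odd 1 1 _ _ hy₁ hx₁ (by decide)
  simp at h00 h01 h10
  simp [h00, h01, h10, e1, e2]
  ring

end Basic

section Matrices

variable (K : Type*) [Field K]

/-- The parity of a row or column index: the first block is even, the second one is odd. -/
def indexParity {m n : Type*} : m ⊕ n → ZMod 2 := Sum.elim (fun _ => 0) (fun _ => 1)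

/-- The superalgebra `M_{r,s}(K)`: all square matrices of order `r + s`; the even ones are the
block diagonal matrices and the odd ones are the block off-diagonal matrices. -/
def matrixSuperalgebra (r s : ℕ) :
    AssocSuperalgebra K (Matrix (Fin r ⊕ Fin s) (Fin r ⊕ Fin s) K) where
  mul := LinearMap.mul K _
  mul_assoc x y z := _root_.mul_assoc x y z
  grade i :=
    { carrier := {X | ∀ p q, indexParity p + indexParity q ≠ i → X p q = 0}
      add_mem' := fun hX hY p q h => by simp [hX p q h, hY p q h]
      zero_mem' := fun _ _ _ => rfl
      smul_mem' := fun c X hX p q h => by simp [hX p q h] }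
  isCompl := by
    constructor
    · rw [Submodule.disjoint_def]
      intro X h0 h1
      ext p q
      by_cases h : indexParity p + indexParity q = 0
      · exact h1 p q (by rw [h]; decide)
      · exact h0 p q h
    · rw [codisjoint_iff, Submodule.eq_top_iff']
      intro X
      refine Submodule.mem_sup.2
        ⟨Matrix.of fun p q => if indexParity p + indexParity q = 0 then X p q else 0,
          fun p q h => by simp [h],
          Matrix.of fun p q => if indexParity p + indexParity q = 0 then 0 else X p q,
          fun p q h => ?_, ?_⟩
      · have : indexParity p + indexParity q = 0 := by
          generalize indexParity p + indexParity q = a at h ⊢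
          revert a; decide
        simp [this]
      · ext p q
        by_cases h : indexParity p + indexParity q = 0 <;> simp [h]
  mul_mem := by
    intro i j X Y hX hY p q h
    rw [LinearMap.mul_apply', Matrix.mul_apply]
    refine Finset.sum_eq_zero fun t _ => ?_
    by_cases h1 : indexParity p + indexParity t = i
    · rw [hY t q, mul_zero]
      rintro rfl
      apply h
      rw [← h1]
      generalize indexParity p = a
      generalize indexParity q = b
      generalize indexParity t = c
      revert a b c; decide
    · rw [hX p t h1, zero_mul]

/-- The algebra of the matrices with blocks `a, b` in the first row and `b, a` in the second,
where `a, b ∈ M_n(K)`. -/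
def queerSubalgebra (n : ℕ) : Subalgebra K (Matrix (Fin n ⊕ Fin n) (Fin n ⊕ Fin n) K) where
  carrier := {X | ∃ a b : Matrix (Fin n) (Fin n) K, X = Matrix.fromBlocks a b b a}
  mul_mem' := by
    rintro _ _ ⟨a, b, rfl⟩ ⟨c, d, rfl⟩
    exact ⟨a * c + b * d, a * d + b * c, by
      rw [Matrix.fromBlocks_multiply, add_comm (b * c), add_comm (b * d)]⟩
  add_mem' := by
    rintro _ _ ⟨a, b, rfl⟩ ⟨c, d, rfl⟩
    exact ⟨a + c, b + d, by rw [Matrix.fromBlocks_add]⟩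
  algebraMap_mem' := fun c =>
    ⟨algebraMap K _ c, 0, by
      ext (p | p) (q | q) <;> simp [Matrix.algebraMap_matrix_apply]⟩

/-- The superalgebra `Q_n(K)`: the matrices with `b = 0` are even, those with `a = 0` are odd. -/
def queerSuperalgebra (n : ℕ) : AssocSuperalgebra K (queerSubalgebra K n) where
  mul := LinearMap.mul K _
  mul_assoc x y z := _root_.mul_assoc x y z
  grade i := ((matrixSuperalgebra K n n).grade i).comap (queerSubalgebra K n).val.toLinearMap
  isCompl := by
    constructor
    · rw [Submodule.disjoint_def]
      intro X h0 h1
      exact Subtype.ext ((matrixSuperalgebra K n n).eq_zero_of_mem h0 h1)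
    · rw [codisjoint_iff, Submodule.eq_top_iff']
      rintro ⟨_, a, b, rfl⟩
      refine Submodule.mem_sup.2
        ⟨⟨Matrix.fromBlocks a 0 0 a, a, 0, rfl⟩, ?_, ⟨Matrix.fromBlocks 0 b b 0, 0, b, rfl⟩, ?_, ?_⟩
      · rintro (p | p) (q | q) h <;> simp [indexParity] at h ⊢
        exact (h (by decide)).elim
      · rintro (p | p) (q | q) h <;> simp [indexParity] at h ⊢
      · exact Subtype.ext (by simp [Matrix.fromBlocks_add])
  mul_mem i j x y hx hy := (matrixSuperalgebra K n n).mul_mem i j _ _ hx hy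

end Matrices

section DoubleExtension

variable {K V W : Type*} [Field K] [AddCommGroup V] [Module K V] [AddCommGroup W] [Module K W]

/-- The natural grading of the dual space: `(V^*)_i` consists of the forms that vanish on
`V_{i+1}`. -/
def dualGrade (T : AssocSuperalgebra K V) (i : ZMod 2) : Submodule K (Module.Dual K V) :=
  (T.grade (i + 1)).dualAnnihilator

/-- The grading of `P(V^*)`, the dual space with its parity reversed. -/
def parityDualGrade (T : AssocSuperalgebra K V) (i : ZMod 2) : Submodule K (Module.Dual K V) :=
  T.dualGrade (i + 1)

theorem mem_parityDualGrade (T : AssocSuperalgebra K V) (i : ZMod 2) (f : Module.Dual K V) :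
    f ∈ T.parityDualGrade i ↔ ∀ v ∈ T.grade i, f v = 0 := by
  have h : i + 1 + 1 = i := by revert i; decide
  rw [parityDualGrade, dualGrade, h, Submodule.mem_dualAnnihilator]

/-- A context of generalized double extension of the odd-symmetric superalgebra `(W, B)` (product
`S.mul`) by the superalgebra `V` (product `T.mul`): even maps `mu : V → End W`,
`lam : V × V → W`, `gam : V × V → P(V^*)` and their compatibility conditions. The map `muAdj v` is
the adjoint of `mu v` with respect to `B` (it is unique since `B` is non-degenerate). -/
structure DoubleExtensionContext (S : AssocSuperalgebra K W) (B : LinearMap.BilinForm K W)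
    (T : AssocSuperalgebra K V) where
  mu : V →ₗ[K] Module.End K W
  muAdj : V →ₗ[K] Module.End K W
  lam : V →ₗ[K] V →ₗ[K] W
  gam : V →ₗ[K] V →ₗ[K] Module.Dual K V
  muAdj_adjoint : ∀ v x y, B (mu v x) y = B x (muAdj v y)
  mu_even : ∀ i j v x, v ∈ T.grade i → x ∈ S.grade j → mu v x ∈ S.grade (i + j)
  lam_even : ∀ i j v w, v ∈ T.grade i → w ∈ T.grade j → lam v w ∈ S.grade (i + j)
  gam_even : ∀ i j v w, v ∈ T.grade i → w ∈ T.grade j → gam v w ∈ T.parityDualGrade (i + j)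
  mu_mul : ∀ v x y, mu v (S.mul x y) = S.mul (mu v x) y
  mu_comm : ∀ v w x, mu v (muAdj w x) = muAdj w (mu v x)
  mu_mu : ∀ v w x, mu v (mu w x) = S.mul (lam v w) x + mu (T.mul v w) x
  lam_cocycle : ∀ u v w,
    lam u (T.mul v w) + mu u (lam v w) = muAdj w (lam u v) + lam (T.mul u v) w
  gam_cyclic : ∀ u v w, gam u v w = gam v w u
  gam_cocycle : ∀ u v w t,
    gam (T.mul u v) w t + gam u v (T.mul w t) - gam u (T.mul v w) t - gam v w (T.mul t u)
      = B (lam t u) (lam v w) - B (lam u v) (lam w t)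

namespace DoubleExtensionContext

variable {S : AssocSuperalgebra K W} {B : LinearMap.BilinForm K W} {T : AssocSuperalgebra K V}

/-- `ν(v, x)(w) = B(x, λ(w, v))`. -/
def nu (C : DoubleExtensionContext S B T) (v : V) (x : W) : Module.Dual K V :=
  B x ∘ₗ C.lam.flip v

/-- `ν'(x, v)(w) = B(x, λ(v, w))`. -/
def nu' (C : DoubleExtensionContext S B T) (x : W) (v : V) : Module.Dual K V :=
  B x ∘ₗ C.lam v

/-- `ψ(x, y)(v) = B(μ(v)(x), y)`. -/
def psi (C : DoubleExtensionContext S B T) (x y : W) : Module.Dual K V :=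
  LinearMap.flip B y ∘ₗ C.mu.flip x

/-- The product of the generalized double extension on `P(V^*) ⊕ W ⊕ V`: the element `f + x + v`
is the triple `(f, x, v)`, the left action of `v` on `P(V^*)` is `g ↦ g ∘ R_v` and the right action
is `f ↦ f ∘ L_v`. -/
def extMul (C : DoubleExtensionContext S B T) :
    (Module.Dual K V × W × V) →ₗ[K] (Module.Dual K V × W × V) →ₗ[K] (Module.Dual K V × W × V) :=
  LinearMap.mk₂ K
    (fun | (f, x, v), (g, y, w) =>
          (C.gam v w + C.nu v y + g ∘ₗ T.mul.flip v + C.nu' x w + f ∘ₗ T.mul w + C.psi x y,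
            C.lam v w + C.mu v y + C.muAdj w x + S.mul x y,
            T.mul v w))
    (by
      rintro ⟨f, x, v⟩ ⟨f', x', v'⟩ ⟨g, y, w⟩
      refine Prod.ext (LinearMap.ext fun t => ?_) (Prod.ext ?_ ?_)
      · simp [nu, nu', psi]; ring
      · simp; abel
      · simp)
    (by
      rintro c ⟨f, x, v⟩ ⟨g, y, w⟩
      refine Prod.ext (LinearMap.ext fun t => ?_) (Prod.ext ?_ ?_)
      · simp [nu, nu', psi]
      · simp
      · simp)
    (by
      rintro ⟨f, x, v⟩ ⟨f', x', v'⟩ ⟨g, y, w⟩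
      refine Prod.ext (LinearMap.ext fun t => ?_) (Prod.ext ?_ ?_)
      · simp [nu, nu', psi]; ring
      · simp; abel
      · simp)
    (by
      rintro c ⟨f, x, v⟩ ⟨g, y, w⟩
      refine Prod.ext (LinearMap.ext fun t => ?_) (Prod.ext ?_ ?_)
      · simp [nu, nu', psi]
      · simp
      · simp)

/-- The bilinear form `(f + x + v, g + y + w) ↦ B(x, y) + f(w) + g(v)` of the generalized double
extension. -/
def extForm (_C : DoubleExtensionContext S B T) :
    LinearMap.BilinForm K (Module.Dual K V × W × V) :=
  LinearMap.mk₂ K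
    (fun | (f, x, v), (g, y, w) => B x y + f w + g v)
    (by rintro ⟨f, x, v⟩ ⟨f', x', v'⟩ ⟨g, y, w⟩; simp; ring)
    (by rintro c ⟨f, x, v⟩ ⟨g, y, w⟩; simp; ring)
    (by rintro ⟨f, x, v⟩ ⟨f', x', v'⟩ ⟨g, y, w⟩; simp; ring)
    (by rintro c ⟨f, x, v⟩ ⟨g, y, w⟩; simp; ring)

theorem muAdj_mul (C : DoubleExtensionContext S B T) (hB : S.IsOddSymmetric B) (v : V) (x y : W) :
    C.muAdj v (S.mul x y) = S.mul x (C.muAdj v y) := by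
  refine sub_eq_zero.1 (hB.nondegenerate.2 _ fun z => ?_)
  rw [map_sub, sub_eq_zero, ← C.muAdj_adjoint, ← hB.assoc, ← hB.assoc, ← C.muAdj_adjoint, C.mu_mul]

theorem mul_mu (C : DoubleExtensionContext S B T) (hB : S.IsOddSymmetric B) (v : V) (x y : W) :
    S.mul x (C.mu v y) = S.mul (C.muAdj v x) y := by
  refine sub_eq_zero.1 (hB.nondegenerate.2 _ fun z => ?_)
  rw [map_sub, sub_eq_zero, ← hB.assoc, hB.symm, C.muAdj_adjoint, C.muAdj_mul hB, hB.symm, hB.assoc]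

theorem muAdj_muAdj (C : DoubleExtensionContext S B T) (hB : S.IsOddSymmetric B) (v w : V)
    (x : W) :
    C.muAdj w (C.muAdj v x) = S.mul x (C.lam v w) + C.muAdj (T.mul v w) x := by
  refine sub_eq_zero.1 (hB.nondegenerate.2 _ fun z => ?_)
  rw [map_sub, sub_eq_zero, ← C.muAdj_adjoint, ← C.muAdj_adjoint, C.mu_mu, map_add, map_add,
    LinearMap.add_apply, ← C.muAdj_adjoint, hB.symm, ← hB.assoc, hB.symm z]

theorem muAdj_even (C : DoubleExtensionContext S B T) (hB : S.IsOddSymmetric B) (i j : ZMod 2)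
    (v : V) (x : W) (hv : v ∈ T.grade i) (hx : x ∈ S.grade j) :
    C.muAdj v x ∈ S.grade (i + j) := by
  have key : ∀ k : ZMod 2, ∀ y z, y ∈ S.grade (k + 1) → z ∈ S.grade k →
      (∀ t ∈ S.grade k, B t (y + z) = 0) → y = 0 := by
    intro k y z hy hz h
    refine hB.nondegenerate.2 _ fun t => ?_
    obtain ⟨t₀, h₀, t₁, h₁, rfl⟩ := S.exists_add t
    have hk : ∀ t ∈ S.grade k, B t y = 0 := fun t ht => by
      have := h t ht
      rwa [map_add, hB.odd k k _ _ ht hz (by clear * -; revert k; decide), add_zero] at this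
    have hk1 : ∀ t ∈ S.grade (k + 1), B t y = 0 := fun t ht =>
      hB.odd _ _ _ _ ht hy (by clear * -; revert k; decide)
    rw [map_add, LinearMap.add_apply]
    obtain rfl | rfl : k = 0 ∨ k = 1 := by clear * -; revert k; decide
    · rw [hk _ h₀, hk1 _ h₁, add_zero]
    · rw [hk _ h₁, hk1 _ h₀, add_zero]
  have hs : ∀ k, ∃ y ∈ S.grade (k + 1), ∃ z ∈ S.grade k, y + z = C.muAdj v x := by
    intro k
    obtain ⟨t₀, h₀, t₁, h₁, h⟩ := S.exists_add (C.muAdj v x)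
    obtain rfl | rfl : k = 0 ∨ k = 1 := by revert k; decide
    · exact ⟨t₁, h₁, t₀, h₀, by rw [add_comm, h]⟩
    · exact ⟨t₀, h₀, t₁, h₁, h⟩
  obtain ⟨y, hy, z, hz, h⟩ := hs (i + j)
  have := key (i + j) y z hy hz fun t ht => by
    rw [h, ← C.muAdj_adjoint]
    exact hB.odd _ _ _ _ (C.mu_even _ _ _ _ hv ht) hx (by clear * -; revert i j; decide)
  rw [← h, this, zero_add]
  exact hz

/-- The generalized double extension of `(W, B)` by `V` as a superalgebra. -/
def extSuperalgebra (C : DoubleExtensionContext S B T) (hB : S.IsOddSymmetric B) :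
    AssocSuperalgebra K (Module.Dual K V × W × V) where
  mul := C.extMul
  mul_assoc := by
    rintro ⟨f, x, a⟩ ⟨g, y, b⟩ ⟨h, z, c⟩
    refine Prod.ext (LinearMap.ext fun t => ?_) (Prod.ext ?_ ?_)
    · have e1 := C.gam_cocycle a b c t
      have e2 := congrArg (B x) (C.lam_cocycle b c t)
      have e3 := congrArg (B y) (C.lam_cocycle c t a)
      have e4 := congrArg (B z) (C.lam_cocycle t a b)
      have e5 := congrArg (fun u => B u y) (C.mu_mu c t x)
      have e6 := congrArg (fun u => B u z) (C.mu_mu t a y)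
      have e7 := congrArg (fun u => B u z) (C.mu_comm t b x)
      have e8 := congrArg (fun u => B u z) (C.mu_mul t x y)
      have adj : ∀ v x y, B (C.muAdj v x) y = B x (C.mu v y) := fun v x y => by
        rw [hB.symm, ← C.muAdj_adjoint, hB.symm]
      have f1 := adj b x (C.lam c t)
      have f2 := C.muAdj_adjoint a y (C.lam c t)
      have f3 := C.muAdj_adjoint t x (C.lam b c)
      have f4 := adj c y (C.lam t a)
      have f5 := hB.symm (C.mu t (C.lam a b)) z
      have f6 := C.muAdj_adjoint b z (C.lam t a)
      have f7 := C.muAdj_adjoint c (C.mu t x) y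
      have f8 := adj b (C.mu t x) z
      have f9 := hB.assoc (C.mu t x) y z
      have f10 := hB.symm (S.mul y z) (C.lam t a)
      have f11 := hB.symm (S.mul x y) (C.lam c t)
      have f12 := hB.symm (C.lam b c) (C.lam t a)
      rw [← hB.assoc] at f10 f11
      simp only [map_add, LinearMap.add_apply] at e2 e3 e4 e5 e6 e7 e8
      simp only [extMul, nu, nu', psi, LinearMap.mk₂_apply, LinearMap.add_apply,
        LinearMap.comp_apply, LinearMap.flip_apply, map_add, T.mul_assoc]
      linear_combination e1 + e2 - e3 + e4 - e5 + e6 + e7 + e8 + f1 + f2 - f3 - f4 + f5 - f6 + f7 + f8 + f9 - f10 + f11 - f12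
    · simp only [extMul, LinearMap.mk₂_apply, LinearMap.add_apply, map_add]
      rw [C.mu_mu, C.muAdj_muAdj hB, C.mu_comm, C.mu_mul, C.muAdj_mul hB, S.mul_assoc,
        C.mul_mu hB]
      rw [← sub_eq_zero]
      have := sub_eq_zero.2 (C.lam_cocycle a b c)
      rw [← neg_eq_zero, ← this]
      abel
    · simp [extMul, T.mul_assoc]
  grade i := (T.parityDualGrade i).prod ((S.grade i).prod (T.grade i))
  isCompl := by
    constructor
    · rw [Submodule.disjoint_def]
      rintro ⟨f, x, v⟩ ⟨hf, hx, hv⟩ ⟨hf', hx', hv'⟩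
      refine Prod.ext (LinearMap.ext fun t => ?_)
        (Prod.ext (S.eq_zero_of_mem hx hx') (T.eq_zero_of_mem hv hv'))
      obtain ⟨t₀, h₀, t₁, h₁, rfl⟩ := T.exists_add t
      have e₀ : f t₀ = 0 := (T.mem_parityDualGrade _ _).1 hf _ h₀
      have e₁ : f t₁ = 0 := (T.mem_parityDualGrade _ _).1 hf' _ h₁
      simp [e₀, e₁]
    · rw [codisjoint_iff, Submodule.eq_top_iff']
      rintro ⟨f, x, v⟩
      obtain ⟨x₀, hx₀, x₁, hx₁, rfl⟩ := S.exists_add x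
      obtain ⟨v₀, hv₀, v₁, hv₁, rfl⟩ := T.exists_add v
      have hd : f ∈ (T.grade 0).dualAnnihilator ⊔ (T.grade 1).dualAnnihilator := by
        rw [← Subspace.dualAnnihilator_inf_eq, T.isCompl.inf_eq_bot]
        simp
      obtain ⟨f₀, hf₀, f₁, hf₁, rfl⟩ := Submodule.mem_sup.1 hd
      rw [Submodule.mem_dualAnnihilator] at hf₀ hf₁
      exact Submodule.mem_sup.2
        ⟨(f₀, x₀, v₀), ⟨(T.mem_parityDualGrade _ _).2 hf₀, hx₀, hv₀⟩,
          (f₁, x₁, v₁), ⟨(T.mem_parityDualGrade _ _).2 hf₁, hx₁, hv₁⟩, rfl⟩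
  mul_mem := by
    rintro i j ⟨f, x, v⟩ ⟨g, y, w⟩ ⟨hf, hx, hv⟩ ⟨hg, hy, hw⟩
    refine ⟨?_, ?_, T.mul_mem _ _ _ _ hv hw⟩
    · replace hf := (T.mem_parityDualGrade _ _).1 hf
      replace hg := (T.mem_parityDualGrade _ _).1 hg
      refine (T.mem_parityDualGrade _ _).2 ?_
      have hgam := (T.mem_parityDualGrade _ _).1 (C.gam_even i j v w hv hw)
      intro t ht
      have a1 : ∀ i j : ZMod 2, i + j + i = j := by decide
      have a2 : ∀ i j : ZMod 2, j + (i + j) = i := by decide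
      have a3 : ∀ i j : ZMod 2, j + (i + j + i) + 1 ≠ 0 := by decide
      have a4 : ∀ i j : ZMod 2, i + (j + (i + j)) + 1 ≠ 0 := by decide
      have a5 : ∀ i j : ZMod 2, i + j + i + j + 1 ≠ 0 := by decide
      have q1 : g (T.mul t v) = 0 := hg _ (a1 i j ▸ T.mul_mem _ _ _ _ ht hv)
      have q2 : f (T.mul w t) = 0 := hf _ (a2 i j ▸ T.mul_mem _ _ _ _ hw ht)
      have q3 : B y (C.lam t v) = 0 := hB.odd _ _ _ _ hy (C.lam_even _ _ _ _ ht hv) (a3 i j)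
      have q4 : B x (C.lam w t) = 0 := hB.odd _ _ _ _ hx (C.lam_even _ _ _ _ hw ht) (a4 i j)
      have q5 : B (C.mu t x) y = 0 := hB.odd _ _ _ _ (C.mu_even _ _ _ _ ht hx) hy (a5 i j)
      simp [extMul, nu, nu', psi, hgam t ht, q1, q2, q3, q4, q5]
    · exact add_mem (add_mem (add_mem (C.lam_even _ _ _ _ hv hw) (C.mu_even _ _ _ _ hv hy))
        (add_comm j i ▸ C.muAdj_even hB _ _ _ _ hw hx)) (S.mul_mem _ _ _ _ hx hy)

end DoubleExtensionContext

/-- `(A, B)` is a generalized double extension by the superalgebra `T` of some (finite-dimensional,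
possibly zero) odd-symmetric superalgebra: it is isomorphic, as a superalgebra with bilinear form,
to the generalized double extension given by some context. -/
def IsDoubleExtensionBy.{u, v, w} {K : Type u} [Field K] {A : Type v} [AddCommGroup A] [Module K A]
    (S : AssocSuperalgebra K A) (B : LinearMap.BilinForm K A)
    {V : Type w} [AddCommGroup V] [Module K V] (T : AssocSuperalgebra K V) : Prop :=
  ∃ (W : Type v) (_ : AddCommGroup W) (_ : Module K W) (_ : FiniteDimensional K W)
    (SW : AssocSuperalgebra K W) (BW : LinearMap.BilinForm K W) (hW : SW.IsOddSymmetric BW)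
    (C : DoubleExtensionContext SW BW T) (e : A ≃ₗ[K] Module.Dual K V × W × V),
    IsIsometricIso S B (C.extSuperalgebra hW) C.extForm e

end DoubleExtension

end AssocSuperalgebra

/-! Let `J` be maximal among the proper graded ideals of `A`. Its orthogonal is a graded ideal, so
`J + J^⊥` is `J` or `A`. If it is `A`, then `B` is non-degenerate on `J`, irreducibility gives `J =
0`, and non-simplicity makes the product null; then `A` is spanned by one homogeneous `x`, and `B(x,
x) = 0` because `B` is odd, which is absurd. Hence `J^⊥ ⊆ J` (`exists_maximal_gradedIdeal`), and `V
= A/J` has no proper nonzero graded ideal: it is null and one-dimensional (`exists_superIso_null`)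
or simple.

The inclusion `J^⊥ ⊆ J` is all that the extension needs (`isDoubleExtensionBy_of_surjective`). The
form identifies `J^⊥` with `V^*`, with reversed parity since `B` is odd. An even section of `A → V`
becomes isotropic after a correction with values in `V^*`. The orthogonal `W` of `V^* ⊕ V` is a
model of `J/J^⊥`, the components of products of elements of `V` and `W` are `μ`, `λ`, `γ`, and the
axioms of a context are associativity in `A` and invariance of `B`.

The simple case is Wall's theorem (`IsSimple.exists_superIso`). A simple `V` acts faithfully on a
minimal graded left ideal `M`. With `ι` the grading involution of `M`, Burnside's theorem gives `V +
Vι = End M`. The elements of `V` that lie in `Vι` form a graded ideal. If it is `V`, then `V = End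
M` is some `M_{r,s}(K)`. If it is `0`, then `V ⊕ Vι` is a grading of `End M`; its parity
automorphism is inner (Skolem–Noether), given by an odd `u` with `u² = 1`, and the centralizer `V`
of `u` is some `Q_n(K)`. -/

namespace AssocSuperalgebra

/-! ### Gradings as involutions -/

section Parity

variable {K A : Type*} [Field K] [AddCommGroup A] [Module K A]

/-- The parity operator of a superalgebra: the identity on the even part and minus the identity
on the odd part. -/
noncomputable def parity (S : AssocSuperalgebra K A) : A →ₗ[K] A :=
  (S.grade 0).projection (S.grade 1) S.isCompl - (S.grade 1).projection (S.grade 0) S.isCompl.symm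

theorem parity_of_mem_zero (S : AssocSuperalgebra K A) {x : A} (hx : x ∈ S.grade 0) :
    S.parity x = x := by
  rw [parity, LinearMap.sub_apply, Submodule.projection_apply_of_mem_left _ hx,
    (Submodule.projection_apply_eq_zero_iff _).2 hx, sub_zero]

theorem parity_of_mem_one (S : AssocSuperalgebra K A) {x : A} (hx : x ∈ S.grade 1) :
    S.parity x = -x := by
  rw [parity, LinearMap.sub_apply, Submodule.projection_apply_of_mem_left _ hx,
    (Submodule.projection_apply_eq_zero_iff _).2 hx, zero_sub]

theorem parity_parity (S : AssocSuperalgebra K A) (x : A) : S.parity (S.parity x) = x := by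
  obtain ⟨x₀, h₀, x₁, h₁, rfl⟩ := S.exists_add x
  simp [S.parity_of_mem_zero h₀, S.parity_of_mem_one h₁]

theorem parity_mul (S : AssocSuperalgebra K A) (x y : A) :
    S.parity (S.mul x y) = S.mul (S.parity x) (S.parity y) := by
  obtain ⟨x₀, h₀, x₁, h₁, rfl⟩ := S.exists_add x
  obtain ⟨y₀, k₀, y₁, k₁, rfl⟩ := S.exists_add y
  have h00 := S.parity_of_mem_zero (S.mul_mem 0 0 _ _ h₀ k₀)
  have h01 := S.parity_of_mem_one (S.mul_mem 0 1 _ _ h₀ k₁)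
  have h10 := S.parity_of_mem_one (S.mul_mem 1 0 _ _ h₁ k₀)
  have h11 := S.parity_of_mem_zero (S.mul_mem 1 1 _ _ h₁ k₁)
  simp [S.parity_of_mem_zero, S.parity_of_mem_one, *]
  abel

/-- Since `2` is invertible, the homogeneous parts are exactly the eigenspaces of the parity
operator. This lets one involution carry the grading: graded subspaces are the stable ones, and even
maps are those that commute with it. -/
theorem mem_grade_iff [CharZero K] (S : AssocSuperalgebra K A) (i : ZMod 2) (x : A) :
    x ∈ S.grade i ↔ S.parity x = (-1 : K) ^ i.val • x := by
  have key : ∀ z : A, (2 : K) • z = 0 → z = 0 := fun z hz =>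
    (smul_eq_zero.1 hz).resolve_left two_ne_zero
  obtain ⟨x₀, h₀, x₁, h₁, rfl⟩ := S.exists_add x
  obtain rfl | rfl : i = 0 ∨ i = 1 := by revert i; decide
  · refine ⟨fun h => by simp [S.parity_of_mem_zero h], fun h => ?_⟩
    rw [map_add, S.parity_of_mem_zero h₀, S.parity_of_mem_one h₁] at h
    have : x₁ = 0 := key _ (by
      simp only [ZMod.val_zero, pow_zero, one_smul] at h
      rw [two_smul]
      nth_rw 1 [← add_left_cancel h]
      simp)
    simpa [this]
  · refine ⟨fun h => by simp [S.parity_of_mem_one h, ZMod.val_one, add_comm], fun h => ?_⟩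
    rw [map_add, S.parity_of_mem_zero h₀, S.parity_of_mem_one h₁] at h
    have : x₀ = 0 := key _ (by
      simp only [ZMod.val_one, pow_one, neg_smul, one_smul, neg_add] at h
      rw [two_smul]
      nth_rw 1 [add_right_cancel h]
      simp)
    simpa [this]

theorem mem_grade_map [CharZero K] {V : Type*} [AddCommGroup V] [Module K V]
    {S : AssocSuperalgebra K A} {T : AssocSuperalgebra K V} {f : A →ₗ[K] V}
    (hf : ∀ x, f (S.parity x) = T.parity (f x)) {i : ZMod 2} {x : A} (hx : x ∈ S.grade i) :
    f x ∈ T.grade i := by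
  rw [mem_grade_iff] at hx ⊢
  rw [← hf, hx, map_smul]

theorem map_parity {V : Type*} [AddCommGroup V] [Module K V]
    {S : AssocSuperalgebra K A} {T : AssocSuperalgebra K V} {f : A →ₗ[K] V}
    (hf : ∀ i x, x ∈ S.grade i → f x ∈ T.grade i) (x : A) :
    f (S.parity x) = T.parity (f x) := by
  obtain ⟨x₀, h₀, x₁, h₁, rfl⟩ := S.exists_add x
  simp [S.parity_of_mem_zero h₀, S.parity_of_mem_one h₁, T.parity_of_mem_zero (hf _ _ h₀),
    T.parity_of_mem_one (hf _ _ h₁)]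

/-- Only pairs of opposite parities contribute to an odd form, and exactly one member of such a pair
changes sign. This minus sign is the source of the parity reversal on `V^*`. -/
theorem IsOddSymmetric.parity_left {S : AssocSuperalgebra K A} {B : LinearMap.BilinForm K A}
    (hB : S.IsOddSymmetric B) (x y : A) : B (S.parity x) y = -B x (S.parity y) := by
  obtain ⟨x₀, h₀, x₁, h₁, rfl⟩ := S.exists_add x
  obtain ⟨y₀, k₀, y₁, k₁, rfl⟩ := S.exists_add y
  have e0 := hB.odd 0 0 _ _ h₀ k₀ (by decide)
  have e1 := hB.odd 1 1 _ _ h₁ k₁ (by decide)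
  simp [S.parity_of_mem_zero h₀, S.parity_of_mem_one h₁, S.parity_of_mem_zero k₀,
    S.parity_of_mem_one k₁, e0, e1, add_comm]

/-- The superalgebra structure given by an associative product and an involutive automorphism:
the even and odd parts are the eigenspaces for `1` and `-1`. -/
def ofParity [CharZero K] (mul : A →ₗ[K] A →ₗ[K] A)
    (mul_assoc : ∀ x y z, mul (mul x y) z = mul x (mul y z)) (σ : A →ₗ[K] A)
    (hσ : ∀ x, σ (σ x) = x) (hmul : ∀ x y, σ (mul x y) = mul (σ x) (σ y)) :
    AssocSuperalgebra K A where
  mul := mul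
  mul_assoc := mul_assoc
  grade i := LinearMap.eqLocus σ ((-1 : K) ^ i.val • LinearMap.id)
  isCompl := by
    constructor
    · rw [Submodule.disjoint_def]
      intro x h₀ h₁
      simp only [LinearMap.mem_eqLocus, ZMod.val_zero, ZMod.val_one, pow_zero, pow_one, one_smul,
        neg_smul, LinearMap.neg_apply, LinearMap.id_apply] at h₀ h₁
      have h : (2 : K) • x = 0 := by
        rw [two_smul]
        nth_rw 1 [← h₀, h₁]
        simp
      exact (smul_eq_zero.1 h).resolve_left two_ne_zero
    · rw [codisjoint_iff, Submodule.eq_top_iff']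
      intro x
      refine Submodule.mem_sup.2
        ⟨(2⁻¹ : K) • (x + σ x), ?_, (2⁻¹ : K) • (x - σ x), ?_, ?_⟩
      · simp [hσ, add_comm]
      · simp [hσ, ZMod.val_one]
      · rw [← smul_add, add_add_sub_cancel, ← two_smul K x, smul_smul,
          inv_mul_cancel₀ two_ne_zero, one_smul]
  mul_mem i j x y hx hy := by
    simp only [LinearMap.mem_eqLocus, LinearMap.smul_apply, LinearMap.id_apply] at hx hy ⊢
    rw [hmul, hx, hy, map_smul, map_smul, LinearMap.smul_apply, smul_smul, ← pow_add]
    congr 1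
    have h : ∀ i : ZMod 2, i = 0 ∨ i = 1 := by decide
    obtain rfl | rfl := h i <;> obtain rfl | rfl := h j <;>
      simp [ZMod.val_one, CharTwo.add_self_eq_zero]

theorem mem_ofParity_grade [CharZero K] {mul : A →ₗ[K] A →ₗ[K] A}
    {mul_assoc : ∀ x y z, mul (mul x y) z = mul x (mul y z)} {σ : A →ₗ[K] A}
    {hσ : ∀ x, σ (σ x) = x} {hmul : ∀ x y, σ (mul x y) = mul (σ x) (σ y)} {i : ZMod 2} {x : A} :
    x ∈ (ofParity mul mul_assoc σ hσ hmul).grade i ↔ σ x = (-1 : K) ^ i.val • x :=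
  Iff.rfl

theorem parity_ofParity [CharZero K] {mul : A →ₗ[K] A →ₗ[K] A}
    {mul_assoc : ∀ x y z, mul (mul x y) z = mul x (mul y z)} {σ : A →ₗ[K] A}
    {hσ : ∀ x, σ (σ x) = x} {hmul : ∀ x y, σ (mul x y) = mul (σ x) (σ y)} (x : A) :
    (ofParity mul mul_assoc σ hσ hmul).parity x = σ x := by
  obtain ⟨x₀, h₀, x₁, h₁, rfl⟩ := (ofParity mul mul_assoc σ hσ hmul).exists_add x
  rw [map_add, parity_of_mem_zero _ h₀, parity_of_mem_one _ h₁]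
  rw [mem_ofParity_grade] at h₀ h₁
  simp [h₀, h₁, ZMod.val_one]

/-- Graded two-sided ideals are the parity-stable two-sided ideals. -/
theorem isGradedIdeal_iff [CharZero K] (S : AssocSuperalgebra K A) (I : Submodule K A) :
    S.IsGradedIdeal I ↔ (∀ a x, x ∈ I → S.mul a x ∈ I) ∧ (∀ x a, x ∈ I → S.mul x a ∈ I) ∧
      ∀ x ∈ I, S.parity x ∈ I := by
  refine ⟨fun h => ⟨h.1, h.2, fun x hx => ?_⟩, fun ⟨h₁, h₂, h₃⟩ => ⟨h₁, h₂, le_antisymm ?_ ?_⟩⟩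
  · rw [h.graded] at hx
    obtain ⟨y, hy, z, hz, rfl⟩ := Submodule.mem_sup.1 hx
    rw [map_add, S.parity_of_mem_zero hy.2, S.parity_of_mem_one hz.2]
    exact add_mem hy.1 (neg_mem hz.1)
  · intro x hx
    refine Submodule.mem_sup.2 ⟨(2⁻¹ : K) • (x + S.parity x),
      ⟨I.smul_mem _ (add_mem hx (h₃ x hx)), ?_⟩, (2⁻¹ : K) • (x - S.parity x),
      ⟨I.smul_mem _ (sub_mem hx (h₃ x hx)), ?_⟩, ?_⟩
    · simp [mem_grade_iff, parity_parity, add_comm]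
    · simp [mem_grade_iff, parity_parity, ZMod.val_one]
    · rw [← smul_add, add_add_sub_cancel, ← two_smul K x, smul_smul,
        inv_mul_cancel₀ two_ne_zero, one_smul]
  · exact sup_le inf_le_left inf_le_left

/-- The product of the quotient of a superalgebra by a graded ideal. -/
def quotientMul (S : AssocSuperalgebra K A) (I : Submodule K A) (hI : S.IsGradedIdeal I) :
    A ⧸ I →ₗ[K] A ⧸ I →ₗ[K] A ⧸ I :=
  I.liftQ (LinearMap.flip (I.liftQ (LinearMap.flip (S.mul.compr₂ I.mkQ))
      fun x hx => LinearMap.ext fun a =>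
        (Submodule.Quotient.mk_eq_zero I).2 (hI.mul_mem_left a x hx)))
    fun x hx => LinearMap.ext fun a => by
      obtain ⟨a, rfl⟩ := I.mkQ_surjective a
      exact (Submodule.Quotient.mk_eq_zero I).2 (hI.mul_mem_right x a hx)

theorem quotientMul_mkQ (S : AssocSuperalgebra K A) (I : Submodule K A) (hI : S.IsGradedIdeal I)
    (x y : A) : S.quotientMul I hI (I.mkQ x) (I.mkQ y) = I.mkQ (S.mul x y) :=
  rfl

/-- The quotient of a superalgebra by a graded ideal. -/
noncomputable def quotient [CharZero K] (S : AssocSuperalgebra K A) (I : Submodule K A)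
    (hI : S.IsGradedIdeal I) : AssocSuperalgebra K (A ⧸ I) :=
  ofParity (S.quotientMul I hI)
    (by
      intro x y z
      obtain ⟨x, rfl⟩ := I.mkQ_surjective x
      obtain ⟨y, rfl⟩ := I.mkQ_surjective y
      obtain ⟨z, rfl⟩ := I.mkQ_surjective z
      simp only [quotientMul_mkQ, S.mul_assoc])
    (I.mapQ I S.parity ((S.isGradedIdeal_iff I).1 hI).2.2)
    (by
      intro x
      obtain ⟨x, rfl⟩ := I.mkQ_surjective x
      simp [S.parity_parity])
    (by
      intro x y
      obtain ⟨x, rfl⟩ := I.mkQ_surjective x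
      obtain ⟨y, rfl⟩ := I.mkQ_surjective y
      exact congrArg I.mkQ (S.parity_mul x y))

theorem quotient_parity [CharZero K] (S : AssocSuperalgebra K A) (I : Submodule K A)
    (hI : S.IsGradedIdeal I) (x : A) :
    (S.quotient I hI).parity (I.mkQ x) = I.mkQ (S.parity x) :=
  parity_ofParity _

end Parity

/-! ### Reconstruction of a double extension from an isotropic splitting -/

section Splitting

variable {K A V : Type*} [Field K] [AddCommGroup A] [Module K A] [AddCommGroup V] [Module K V]

/-- A surjective homomorphism of superalgebras `proj : A → V` together with an even isotropic
linear section `sec` and the embedding `emb : V^* → A` dual to `proj`, whose image lies in the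
kernel of `proj`. -/
structure IsotropicSplitting (S : AssocSuperalgebra K A) (B : LinearMap.BilinForm K A)
    (T : AssocSuperalgebra K V) where
  proj : A →ₗ[K] V
  sec : V →ₗ[K] A
  emb : Module.Dual K V →ₗ[K] A
  proj_mul : ∀ a b, proj (S.mul a b) = T.mul (proj a) (proj b)
  proj_parity : ∀ a, proj (S.parity a) = T.parity (proj a)
  proj_sec : ∀ v, proj (sec v) = v
  sec_parity : ∀ v, sec (T.parity v) = S.parity (sec v)
  sec_isotropic : ∀ v w, B (sec v) (sec w) = 0
  form_emb : ∀ f a, B (emb f) a = f (proj a)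
  proj_emb : ∀ f, proj (emb f) = 0

/-- For an invariant symmetric form, left and right multiplication by `z` are mutually adjoint;
hence right multiplication plays the role of `μ(v)^*`. -/
theorem IsOddSymmetric.form_mul_left {S : AssocSuperalgebra K A} {B : LinearMap.BilinForm K A}
    (hB : S.IsOddSymmetric B) (x y z : A) : B (S.mul z x) y = B x (S.mul y z) := by
  rw [hB.assoc, hB.symm, hB.assoc]

namespace IsotropicSplitting

variable {S : AssocSuperalgebra K A} {B : LinearMap.BilinForm K A} {T : AssocSuperalgebra K V}

/-- The component in `V^*` of an element of `A`. -/
def coeff (D : IsotropicSplitting S B T) : A →ₗ[K] Module.Dual K V := B.compl₂ D.sec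

/-- The orthogonal of the sum of the images of `sec` and `emb`. -/
def core (D : IsotropicSplitting S B T) : Submodule K A :=
  LinearMap.ker D.proj ⊓ LinearMap.ker D.coeff

theorem coeff_apply (D : IsotropicSplitting S B T) (a : A) (v : V) :
    D.coeff a v = B a (D.sec v) := rfl

theorem proj_core (D : IsotropicSplitting S B T) (x : D.core) : D.proj x = 0 := x.2.1

theorem form_core_sec (D : IsotropicSplitting S B T) (x : D.core) (v : V) :
    B x (D.sec v) = 0 := by
  rw [← coeff_apply, LinearMap.mem_ker.1 x.2.2, LinearMap.zero_apply]

theorem coeff_emb (D : IsotropicSplitting S B T) (f : Module.Dual K V) :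
    D.coeff (D.emb f) = f :=
  LinearMap.ext fun v => by rw [coeff_apply, form_emb, proj_sec]

theorem coeff_sec (D : IsotropicSplitting S B T) (v : V) : D.coeff (D.sec v) = 0 :=
  LinearMap.ext fun w => D.sec_isotropic v w

/-- The projection of `A` onto the core along the images of `sec` and `emb`. -/
def toCore (D : IsotropicSplitting S B T) : A →ₗ[K] D.core :=
  LinearMap.codRestrict D.core (LinearMap.id - D.sec ∘ₗ D.proj - D.emb ∘ₗ D.coeff) fun a => by
    refine ⟨?_, ?_⟩
    · simp [proj_sec, proj_emb]
    · simp [coeff_sec, coeff_emb]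

theorem coe_toCore (D : IsotropicSplitting S B T) (a : A) :
    (D.toCore a : A) = a - D.sec (D.proj a) - D.emb (D.coeff a) := rfl

theorem toCore_coe (D : IsotropicSplitting S B T) (x : D.core) : D.toCore x = x :=
  Subtype.ext (by
    rw [coe_toCore, proj_core, LinearMap.mem_ker.1 x.2.2, map_zero, map_zero, sub_zero, sub_zero])

theorem toCore_emb (D : IsotropicSplitting S B T) (f : Module.Dual K V) :
    D.toCore (D.emb f) = 0 :=
  Subtype.ext (by simp [coe_toCore, proj_emb, coeff_emb])

theorem toCore_sec (D : IsotropicSplitting S B T) (v : V) : D.toCore (D.sec v) = 0 :=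
  Subtype.ext (by simp [coe_toCore, proj_sec, coeff_sec])

theorem form_toCore_core (D : IsotropicSplitting S B T) (hB : S.IsOddSymmetric B) (a : A)
    (x : D.core) : B (D.toCore a) x = B a x := by
  simp [coe_toCore, hB.symm (D.sec _) x, form_core_sec, form_emb, proj_core]

theorem form_core_toCore (D : IsotropicSplitting S B T) (hB : S.IsOddSymmetric B) (x : D.core)
    (a : A) : B x (D.toCore a) = B x a := by
  rw [hB.symm, form_toCore_core D hB, hB.symm]

/-- The three summands pair only core with core and `V^*` with `V`, so removing the two mixed terms
from `B a b` leaves the core part. Every identity that involves `γ`, `ν`, `ν'` or `ψ` reduces to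
this formula. -/
theorem form_toCore_toCore (D : IsotropicSplitting S B T) (hB : S.IsOddSymmetric B) (a b : A) :
    B (D.toCore a) (D.toCore b) = B a b - B a (D.sec (D.proj b)) - B b (D.sec (D.proj a)) := by
  rw [form_toCore_core D hB, coe_toCore D b, map_sub, map_sub, hB.symm a (D.emb _), form_emb,
    coeff_apply]

theorem core_ext (D : IsotropicSplitting S B T) (hB : S.IsOddSymmetric B) {x : D.core}
    (h : ∀ y : D.core, B x y = 0) : x = 0 := by
  refine Subtype.ext (hB.nondegenerate.1 _ fun a => ?_)
  rw [← form_core_toCore D hB, h]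

/-- Pairing with `b` moves the product onto `b`, where `proj` is multiplicative. So the image of
`emb` is an ideal carrying the dual actions of `V`. -/
theorem mul_emb (D : IsotropicSplitting S B T) (hB : S.IsOddSymmetric B) (a : A)
    (f : Module.Dual K V) : S.mul a (D.emb f) = D.emb (f ∘ₗ T.mul.flip (D.proj a)) := by
  refine sub_eq_zero.1 (hB.nondegenerate.1 _ fun b => ?_)
  rw [map_sub, LinearMap.sub_apply, hB.symm (S.mul _ _), ← hB.assoc, hB.symm, form_emb, form_emb,
    proj_mul, LinearMap.comp_apply, LinearMap.flip_apply, sub_self]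

theorem emb_mul (D : IsotropicSplitting S B T) (hB : S.IsOddSymmetric B) (a : A)
    (f : Module.Dual K V) : S.mul (D.emb f) a = D.emb (f ∘ₗ T.mul (D.proj a)) := by
  refine sub_eq_zero.1 (hB.nondegenerate.1 _ fun b => ?_)
  rw [map_sub, LinearMap.sub_apply, hB.assoc, form_emb, form_emb,
    proj_mul, LinearMap.comp_apply, sub_self]

/-- The `V^*` part of `a` contributes nothing, because its products stay in the image of `emb`,
which `toCore` kills. -/
theorem toCore_mul_left (D : IsotropicSplitting S B T) (hB : S.IsOddSymmetric B) (a b : A) :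
    D.toCore (S.mul a b)
      = D.toCore (S.mul (D.toCore a) b) + D.toCore (S.mul (D.sec (D.proj a)) b) := by
  simp [coe_toCore, emb_mul D hB, toCore_emb]

theorem toCore_mul_right (D : IsotropicSplitting S B T) (hB : S.IsOddSymmetric B) (a b : A) :
    D.toCore (S.mul a b)
      = D.toCore (S.mul a (D.toCore b)) + D.toCore (S.mul a (D.sec (D.proj b))) := by
  simp [coe_toCore, mul_emb D hB, toCore_emb]

/-- On the kernel of `proj`, the core behaves as the quotient by the image of `emb`, so inner
projections may be dropped. Associativity on the core and the axioms on `μ` follow from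
associativity in `A` in this way. -/
theorem toCore_mul_left_of_proj (D : IsotropicSplitting S B T) (hB : S.IsOddSymmetric B) {a : A}
    (b : A) (ha : D.proj a = 0) :
    D.toCore (S.mul (D.toCore a) b) = D.toCore (S.mul a b) := by
  rw [D.toCore_mul_left hB a b, ha]; simp

theorem toCore_mul_right_of_proj (D : IsotropicSplitting S B T) (hB : S.IsOddSymmetric B) (a : A)
    {b : A} (hb : D.proj b = 0) :
    D.toCore (S.mul a (D.toCore b)) = D.toCore (S.mul a b) := by
  rw [D.toCore_mul_right hB a b, hb]; simp

/-- The sign comes from the oddness of `B`: it says that `emb` is even on `P(V^*)`, not on `V^*`. -/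
theorem parity_emb (D : IsotropicSplitting S B T) (hB : S.IsOddSymmetric B)
    (f : Module.Dual K V) : S.parity (D.emb f) = -D.emb (f ∘ₗ T.parity) := by
  refine sub_eq_zero.1 (hB.nondegenerate.1 _ fun b => ?_)
  simp [hB.parity_left, form_emb, proj_parity]

theorem coeff_parity (D : IsotropicSplitting S B T) (hB : S.IsOddSymmetric B) (a : A) :
    D.coeff (S.parity a) = -(D.coeff a ∘ₗ T.parity) :=
  LinearMap.ext fun v => by simp [coeff_apply, hB.parity_left, sec_parity]

theorem toCore_parity (D : IsotropicSplitting S B T) (hB : S.IsOddSymmetric B) (a : A) :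
    (D.toCore (S.parity a) : A) = S.parity (D.toCore a) := by
  simp [coe_toCore, proj_parity, sec_parity, coeff_parity D hB, parity_emb D hB]

/-- The decomposition of `A` as the sum of `V^*`, the core and `V`. -/
def decomposition (D : IsotropicSplitting S B T) :
    A ≃ₗ[K] Module.Dual K V × D.core × V :=
  LinearEquiv.ofLinearMap (D.coeff.prod (D.toCore.prod D.proj))
    (D.emb.coprod (D.core.subtype.coprod D.sec))
    (by
      ext1
      · exact LinearMap.ext fun f => by simp [coeff_emb, toCore_emb, proj_emb]
      ext1
      · exact LinearMap.ext fun x => by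
          simp [LinearMap.mem_ker.1 x.2.2, toCore_coe, proj_core]
      · exact LinearMap.ext fun v => by simp [coeff_sec, toCore_sec, proj_sec])
    (LinearMap.ext fun a => by simp [coe_toCore]; abel)

theorem decomposition_apply (D : IsotropicSplitting S B T) (a : A) :
    D.decomposition a = (D.coeff a, D.toCore a, D.proj a) := rfl

variable [CharZero K]

/-- The odd-symmetric superalgebra carried by the core. -/
noncomputable def coreSuperalgebra (D : IsotropicSplitting S B T) (hB : S.IsOddSymmetric B) :
    AssocSuperalgebra K D.core :=
  ofParity ((S.mul.compl₁₂ D.core.subtype D.core.subtype).compr₂ D.toCore)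
    (fun x y z => by
      simp only [LinearMap.compr₂_apply, LinearMap.compl₁₂_apply, Submodule.subtype_apply]
      rw [D.toCore_mul_left_of_proj hB, D.toCore_mul_right_of_proj hB, S.mul_assoc] <;>
        simp [proj_mul, proj_core])
    (D.toCore ∘ₗ S.parity ∘ₗ D.core.subtype)
    (fun x => by
      refine Subtype.ext ?_
      simp [toCore_parity D hB, parity_parity, toCore_coe])
    (fun x y => by
      refine Subtype.ext ?_
      simp [toCore_parity D hB, ← parity_mul, toCore_coe])

theorem mem_coreSuperalgebra_grade (D : IsotropicSplitting S B T) (hB : S.IsOddSymmetric B)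
    (i : ZMod 2) (x : D.core) : x ∈ (D.coreSuperalgebra hB).grade i ↔ (x : A) ∈ S.grade i := by
  rw [coreSuperalgebra, mem_ofParity_grade, S.mem_grade_iff, Subtype.ext_iff]
  simp [toCore_parity D hB, toCore_coe]

theorem toCore_mem_grade (D : IsotropicSplitting S B T) (hB : S.IsOddSymmetric B)
    {i : ZMod 2} {a : A} (ha : a ∈ S.grade i) : D.toCore a ∈ (D.coreSuperalgebra hB).grade i := by
  rw [mem_coreSuperalgebra_grade, mem_grade_iff, ← toCore_parity D hB, (S.mem_grade_iff _ _).1 ha]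
  simp

theorem coreSuperalgebra_isOddSymmetric (D : IsotropicSplitting S B T)
    (hB : S.IsOddSymmetric B) : (D.coreSuperalgebra hB).IsOddSymmetric (B.restrict D.core) where
  odd i j x y hx hy h := by
    rw [mem_coreSuperalgebra_grade] at hx hy
    exact hB.odd i j _ _ hx hy h
  supersymm i j x y hx hy := by
    rw [mem_coreSuperalgebra_grade] at hx hy
    exact hB.supersymm i j _ _ hx hy
  assoc x y z := by
    change B (D.toCore (S.mul x y)) z = B x (D.toCore (S.mul y z))
    rw [form_toCore_core D hB, form_core_toCore D hB, hB.assoc]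
  nondegenerate := ⟨fun x h => D.core_ext hB h,
    fun x h => D.core_ext hB fun y => by rw [hB.symm]; exact h y⟩

/-- The context of generalized double extension defined by an isotropic splitting. -/
noncomputable def context (D : IsotropicSplitting S B T) (hB : S.IsOddSymmetric B) :
    DoubleExtensionContext (D.coreSuperalgebra hB) (B.restrict D.core) T where
  mu := (S.mul.compl₁₂ D.sec D.core.subtype).compr₂ D.toCore
  muAdj := (S.mul.flip.compl₁₂ D.sec D.core.subtype).compr₂ D.toCore
  lam := (S.mul.compl₁₂ D.sec D.sec).compr₂ D.toCore
  gam := (S.mul.compl₁₂ D.sec D.sec).compr₂ D.coeff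
  muAdj_adjoint v x y := by
    change B (D.toCore (S.mul (D.sec v) x)) y = B x (D.toCore (S.mul y (D.sec v)))
    rw [form_toCore_core D hB, form_core_toCore D hB, hB.form_mul_left]
  mu_even i j v x hv hx := by
    rw [mem_coreSuperalgebra_grade] at hx
    exact D.toCore_mem_grade hB (S.mul_mem _ _ _ _
      (mem_grade_map (S := T) (T := S) D.sec_parity hv) hx)
  lam_even i j v w hv hw :=
    D.toCore_mem_grade hB (S.mul_mem _ _ _ _ (mem_grade_map (S := T) (T := S) D.sec_parity hv)
      (mem_grade_map (S := T) (T := S) D.sec_parity hw))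
  gam_even i j v w hv hw := by
    rw [mem_parityDualGrade]
    intro t ht
    exact hB.odd _ _ _ _ (S.mul_mem _ _ _ _ (mem_grade_map (S := T) (T := S) D.sec_parity hv)
      (mem_grade_map (S := T) (T := S) D.sec_parity hw))
      (mem_grade_map (S := T) (T := S) D.sec_parity ht) (by clear * -; revert i j; decide)
  mu_mul v x y := by
    change D.toCore (S.mul (D.sec v) (D.toCore (S.mul x y))) =
      D.toCore (S.mul (D.toCore (S.mul (D.sec v) x)) y)
    rw [D.toCore_mul_right_of_proj hB, D.toCore_mul_left_of_proj hB, S.mul_assoc] <;>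
      simp [proj_mul, proj_core]
  mu_comm v w x := by
    change D.toCore (S.mul (D.sec v) (D.toCore (S.mul x (D.sec w)))) =
      D.toCore (S.mul (D.toCore (S.mul (D.sec v) x)) (D.sec w))
    rw [D.toCore_mul_right_of_proj hB, D.toCore_mul_left_of_proj hB, S.mul_assoc] <;>
      simp [proj_mul, proj_core]
  mu_mu v w x := by
    change D.toCore (S.mul (D.sec v) (D.toCore (S.mul (D.sec w) x))) =
      D.toCore (S.mul (D.toCore (S.mul (D.sec v) (D.sec w))) x) +
        D.toCore (S.mul (D.sec (T.mul v w)) x)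
    rw [D.toCore_mul_right_of_proj hB _ (by simp [proj_mul, proj_core]), ← S.mul_assoc,
      D.toCore_mul_left hB, proj_mul, proj_sec, proj_sec]
  lam_cocycle u v w := by
    change D.toCore (S.mul (D.sec u) (D.sec (T.mul v w))) +
        D.toCore (S.mul (D.sec u) (D.toCore (S.mul (D.sec v) (D.sec w)))) =
      D.toCore (S.mul (D.toCore (S.mul (D.sec u) (D.sec v))) (D.sec w)) +
        D.toCore (S.mul (D.sec (T.mul u v)) (D.sec w))
    have h := congrArg D.toCore (S.mul_assoc (D.sec u) (D.sec v) (D.sec w))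
    rw [D.toCore_mul_left hB, D.toCore_mul_right hB _ (S.mul _ _)] at h
    simp only [proj_mul, proj_sec] at h
    rw [h, add_comm]
  gam_cyclic u v w := by
    change B (S.mul (D.sec u) (D.sec v)) (D.sec w) = B (S.mul (D.sec v) (D.sec w)) (D.sec u)
    rw [hB.assoc, hB.symm]
  gam_cocycle u v w t := by
    change B (S.mul (D.sec (T.mul u v)) (D.sec w)) (D.sec t) +
        B (S.mul (D.sec u) (D.sec v)) (D.sec (T.mul w t)) -
        B (S.mul (D.sec u) (D.sec (T.mul v w))) (D.sec t) -
        B (S.mul (D.sec v) (D.sec w)) (D.sec (T.mul t u)) =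
      B (D.toCore (S.mul (D.sec t) (D.sec u))) (D.toCore (S.mul (D.sec v) (D.sec w))) -
        B (D.toCore (S.mul (D.sec u) (D.sec v))) (D.toCore (S.mul (D.sec w) (D.sec t)))
    -- After the expansion, the two pairings of products of four sections agree by invariance and
    -- symmetry. The remaining terms, which involve sections of products in `V`, are those of the
    -- left side.
    simp only [form_toCore_toCore D hB, proj_mul, proj_sec]
    have h1 := hB.assoc (D.sec (T.mul u v)) (D.sec w) (D.sec t)
    have h2 := hB.symm (S.mul (D.sec w) (D.sec t)) (D.sec (T.mul u v))
    have h3 := hB.assoc (D.sec t) (D.sec u) (D.sec (T.mul v w))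
    have h4 := hB.symm (S.mul (D.sec u) (D.sec (T.mul v w))) (D.sec t)
    have h5 := hB.assoc (D.sec t) (D.sec u) (S.mul (D.sec v) (D.sec w))
    have h6 := hB.symm (S.mul (D.sec u) (S.mul (D.sec v) (D.sec w))) (D.sec t)
    have h7 := hB.assoc (S.mul (D.sec u) (D.sec v)) (D.sec w) (D.sec t)
    rw [S.mul_assoc] at h7
    linear_combination h1 - h2 + h3 - h4 - h5 + h6 - h7

theorem isIsometricIso (D : IsotropicSplitting S B T) (hB : S.IsOddSymmetric B) :
    IsIsometricIso S B
      ((D.context hB).extSuperalgebra (D.coreSuperalgebra_isOddSymmetric hB))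
      (D.context hB).extForm D.decomposition where
  map_mul a b := by
    rw [decomposition_apply, decomposition_apply, decomposition_apply]
    refine Prod.ext (LinearMap.ext fun t => ?_) (Prod.ext ?_ (D.proj_mul a b))
    · change B (S.mul a b) (D.sec t) =
        B (S.mul (D.sec (D.proj a)) (D.sec (D.proj b))) (D.sec t) +
        B (D.toCore b) (D.toCore (S.mul (D.sec t) (D.sec (D.proj a)))) +
        B b (D.sec (T.mul t (D.proj a))) +
        B (D.toCore a) (D.toCore (S.mul (D.sec (D.proj b)) (D.sec t))) +
        B a (D.sec (T.mul (D.proj b) t)) +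
        B (D.toCore (S.mul (D.sec t) (D.toCore a))) (D.toCore b)
      -- `h2` merges the `ψ` and `ν'` terms into the pairing of `sec t · toCore a` with `b`; `h1`
      -- evaluates that pairing, and `h3` evaluates the `ν` term.
      have h1 := D.form_toCore_toCore hB a (S.mul b (D.sec t))
      have h2 := D.form_toCore_toCore hB (S.mul (D.sec t) (D.toCore a)) b
      have h3 := D.form_toCore_toCore hB (S.mul (D.sec t) (D.sec (D.proj a))) b
      rw [proj_mul, proj_sec, form_core_toCore D hB, ← hB.form_mul_left,
        hB.symm (S.mul b _), ← hB.form_mul_left] at h1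
      rw [proj_mul, proj_core, map_zero, map_zero, map_zero, sub_zero,
        hB.form_mul_left _ (D.sec (D.proj b)), ← form_core_toCore D hB _ (S.mul _ (D.sec t))] at h2
      rw [proj_mul, proj_sec, hB.assoc _ _ (D.sec (D.proj b)), hB.symm (D.sec t)] at h3
      rw [hB.assoc, hB.symm (D.toCore b) (D.toCore (S.mul _ _))]
      rw [proj_sec] at h3
      linear_combination -h1 - h2 - h3 - hB.form_mul_left a b (D.sec t) -
        hB.form_mul_left (D.sec (D.proj a)) b (D.sec t)
    · change D.toCore (S.mul a b) =
        D.toCore (S.mul (D.sec (D.proj a)) (D.sec (D.proj b))) +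
        D.toCore (S.mul (D.sec (D.proj a)) (D.toCore b)) +
        D.toCore (S.mul (D.toCore a) (D.sec (D.proj b))) +
        D.toCore (S.mul (D.toCore a) (D.toCore b))
      rw [D.toCore_mul_left hB, D.toCore_mul_right hB, D.toCore_mul_right hB _ b]
      abel
  map_grade i a := by
    have e : D.decomposition a ∈ ((D.context hB).extSuperalgebra
          (D.coreSuperalgebra_isOddSymmetric hB)).grade i ↔
        D.coeff a ∈ T.parityDualGrade i ∧ D.toCore a ∈ (D.coreSuperalgebra hB).grade i ∧
          D.proj a ∈ T.grade i := Iff.rfl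
    rw [e, mem_coreSuperalgebra_grade]
    refine ⟨fun ha => ⟨?_, ?_, mem_grade_map D.proj_parity ha⟩, fun ⟨h₁, h₂, h₃⟩ => ?_⟩
    · rw [mem_parityDualGrade]
      intro v hv
      exact hB.odd _ _ _ _ ha (mem_grade_map (S := T) (T := S) D.sec_parity hv)
        (by clear * -; revert i; decide)
    · rw [← mem_coreSuperalgebra_grade D hB]
      exact D.toCore_mem_grade hB ha
    · have h : a = D.emb (D.coeff a) + D.toCore a + D.sec (D.proj a) := by
        rw [coe_toCore]; abel
      rw [h]
      refine add_mem (add_mem ?_ h₂) (mem_grade_map (S := T) (T := S) D.sec_parity h₃)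
      -- The minus sign of `parity_emb` makes a functional vanishing on `V_i` give an element of
      -- degree `i`.
      rw [mem_grade_iff, parity_emb D hB, ← map_smul, ← map_neg]
      congr 1
      refine LinearMap.ext fun v => ?_
      obtain ⟨v₀, k₀, v₁, k₁, rfl⟩ := T.exists_add v
      rw [mem_parityDualGrade] at h₁
      obtain rfl | rfl : i = 0 ∨ i = 1 := by clear * -; revert i; decide
      · simp [T.parity_of_mem_zero k₀, T.parity_of_mem_one k₁, h₁ _ k₀]
      · simp [T.parity_of_mem_zero k₀, T.parity_of_mem_one k₁, h₁ _ k₁, ZMod.val_one]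
  map_form a b := by
    change B (D.toCore a) (D.toCore b) + B a (D.sec (D.proj b)) + B b (D.sec (D.proj a)) = B a b
    rw [form_toCore_toCore D hB]
    ring

end IsotropicSplitting

/-- A superalgebra with an odd-symmetric structure is a generalized double extension by every
quotient superalgebra for which the orthogonal of the kernel is contained in the kernel. -/
theorem isDoubleExtensionBy_of_surjective [CharZero K] [FiniteDimensional K A]
    {S : AssocSuperalgebra K A} {B : LinearMap.BilinForm K A} {T : AssocSuperalgebra K V}
    (hB : S.IsOddSymmetric B) (π : A →ₗ[K] V) (hsurj : Function.Surjective π)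
    (hmul : ∀ a b, π (S.mul a b) = T.mul (π a) (π b))
    (hpar : ∀ a, π (S.parity a) = T.parity (π a))
    (hker : ∀ a, (∀ b, π b = 0 → B a b = 0) → π a = 0) :
    S.IsDoubleExtensionBy B T := by
  obtain ⟨r, hr⟩ := π.exists_rightInverse_of_surjective (LinearMap.range_eq_top.2 hsurj)
  replace hr : ∀ v, π (r v) = v := fun v => LinearMap.congr_fun hr v
  -- Averaging a linear section with its conjugate under the parity operators makes it even.
  set s : V →ₗ[K] A := (2⁻¹ : K) • (r + S.parity ∘ₗ r ∘ₗ T.parity) with hs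
  have hs_par : ∀ v, s (T.parity v) = S.parity (s v) := fun v => by
    simp [hs, parity_parity, add_comm]
  have hs_proj : ∀ v, π (s v) = v := fun v => by
    simp only [hs, LinearMap.smul_apply, LinearMap.add_apply, LinearMap.comp_apply, map_smul,
      map_add, hpar, hr, parity_parity]
    rw [← two_smul K v, smul_smul, inv_mul_cancel₀ two_ne_zero, one_smul]
  set ι : Module.Dual K V →ₗ[K] A :=
    (LinearMap.BilinForm.toDual B hB.nondegenerate).symm.toLinearMap ∘ₗ π.dualMap with hι
  have hι_form : ∀ f a, B (ι f) a = f (π a) := fun f a => by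
    simp [hι, LinearMap.BilinForm.apply_toDual_symm_apply]
  have hι_proj : ∀ f, π (ι f) = 0 := fun f => hker _ fun b hb => by rw [hι_form, hb, map_zero]
  have hι_par : ∀ f, S.parity (ι f) = -ι (f ∘ₗ T.parity) := fun f =>
    sub_eq_zero.1 (hB.nondegenerate.1 _ fun b => by simp [hB.parity_left, hι_form, hpar])
  let q : V →ₗ[K] Module.Dual K V := B.compl₁₂ s s
  have hq : ∀ v w, q v w = B (s v) (s w) := fun _ _ => rfl
  have hq_par : ∀ v, q (T.parity v) = -(q v ∘ₗ T.parity) := fun v => LinearMap.ext fun w => by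
    simp [hq, hs_par, hB.parity_left]
  let D : IsotropicSplitting S B T :=
    { proj := π
      sec := s - (2⁻¹ : K) • (ι ∘ₗ q)
      emb := ι
      proj_mul := hmul
      proj_parity := hpar
      proj_sec := fun v => by simp [hs_proj, hι_proj]
      sec_parity := fun v => by simp [hs_par, hι_par, hq_par]
      sec_isotropic := fun v w => by
        simp only [LinearMap.sub_apply, LinearMap.smul_apply, LinearMap.comp_apply, map_sub,
          map_smul, hι_form, hs_proj, hι_proj, hB.symm (s v) (ι _), hq, hB.symm (s w) (s v)]
        simp
        ring
      form_emb := hι_form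
      proj_emb := hι_proj }
  exact ⟨D.core, _, _, inferInstance, _, _, D.coreSuperalgebra_isOddSymmetric hB, D.context hB,
    D.decomposition, D.isIsometricIso hB⟩

end Splitting

end AssocSuperalgebra

/-! ### Burnside's theorem without a unit -/

/-- Burnside's theorem: a nonzero multiplicatively closed space of endomorphisms acting
irreducibly on a finite-dimensional space over an algebraically closed field contains all
endomorphisms. -/
theorem Module.End.eq_top_of_irreducible {K M : Type*} [Field K] [IsAlgClosed K] [AddCommGroup M]
    [Module K M] [FiniteDimensional K M] (N : Submodule K (Module.End K M))
    (hmul : ∀ x ∈ N, ∀ y ∈ N, x * y ∈ N) (hne : N ≠ ⊥)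
    (hirr : ∀ P : Submodule K M, (∀ n ∈ N, ∀ x ∈ P, n x ∈ P) → P = ⊥ ∨ P = ⊤) : N = ⊤ := by
  obtain ⟨n, hn, hn0⟩ := N.ne_bot_iff.1 hne
  obtain ⟨m, hm⟩ : ∃ m, n m ≠ 0 := by
    by_contra! h
    exact hn0 (LinearMap.ext h)
  have : Nontrivial M := ⟨⟨_, _, hm⟩⟩
  -- `N` need not contain the identity. Schur's lemma and the density theorem are applied to the
  -- unital algebra it generates, and `N` is then seen to be a nonzero ideal of that algebra.
  let R : Subalgebra K (Module.End K M) := Algebra.adjoin K (N : Set (Module.End K M))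
  have hsmul : ∀ (r : R) (x : M), r • x = (r : Module.End K M) x := fun _ _ => rfl
  have hNR : ∀ n ∈ N, n ∈ R := fun n hn => Algebra.subset_adjoin hn
  have hsimple : IsSimpleModule R M := by
    rw [isSimpleModule_iff]
    exact
      { eq_bot_or_eq_top := fun P => by
          obtain h | h := hirr (P.restrictScalars K) fun n hn x hx => P.smul_mem ⟨n, hNR n hn⟩ hx
          · left
            rwa [Submodule.restrictScalars_eq_bot_iff] at h
          · right
            rwa [Submodule.restrictScalars_eq_top_iff] at h }
  -- An eigenspace of `e` is nonzero and `N`-stable, hence everything.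
  have hschur : ∀ e : Module.End R M, ∃ c : K, ∀ x, e x = c • x := by
    intro e
    obtain ⟨c, hc⟩ := Module.End.exists_eigenvalue (e.restrictScalars K)
    refine ⟨c, fun x => ?_⟩
    obtain h | h := hirr (Module.End.eigenspace (e.restrictScalars K) c) fun n hn x hx => by
      rw [Module.End.mem_eigenspace_iff] at hx ⊢
      change e x = c • x at hx
      change e ((⟨n, hNR n hn⟩ : R) • x) = c • n x
      rw [map_smul, hx, hsmul, map_smul]
    · exact (hc h).elim
    · exact Module.End.mem_eigenspace_iff.1 (h ▸ Submodule.mem_top : x ∈ _)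
  have hR : ∀ g : Module.End K M, g ∈ R := by
    intro g
    -- Since the commutant consists of scalars, every `g` lies in the bicommutant; density on a
    -- finite basis then realizes `g` in `R`.
    let F : Module.End (Module.End R M) M :=
      { g with
        map_smul' := fun e x => by
          obtain ⟨c, hc⟩ := hschur e
          change g (e x) = e (g x)
          rw [hc, hc, map_smul] }
    classical
    obtain ⟨r, hr⟩ := jacobson_density F
      (Finset.univ.image (Module.finBasis K M))
    have : g = r := (Module.finBasis K M).ext fun i => hr _ (by simp)
    exact this ▸ r.2
  have hl : ∀ r ∈ R, ∀ n ∈ N, r * n ∈ N := fun r hr =>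
    Algebra.adjoin_induction (p := fun r _ => ∀ n ∈ N, r * n ∈ N) (fun x hx n hn => hmul x hx n hn)
      (fun c n hn => by rw [← Algebra.smul_def]; exact N.smul_mem c hn)
      (fun x y _ _ hx hy n hn => by rw [add_mul]; exact add_mem (hx n hn) (hy n hn))
      (fun x y _ _ hx hy n hn => by rw [mul_assoc]; exact hx _ (hy n hn)) hr
  have hr : ∀ r ∈ R, ∀ n ∈ N, n * r ∈ N := fun r hr =>
    Algebra.adjoin_induction (p := fun r _ => ∀ n ∈ N, n * r ∈ N) (fun x hx n hn => hmul n hn x hx)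
      (fun c n hn => by rw [← Algebra.commutes, ← Algebra.smul_def]; exact N.smul_mem c hn)
      (fun x y _ _ hx hy n hn => by rw [mul_add]; exact add_mem (hx n hn) (hy n hn))
      (fun x y _ _ hx hy n hn => by rw [← mul_assoc]; exact hy _ (hx n hn)) hr
  -- With `d (n m) = 1`, sandwiching `n` between two rank-one maps yields any prescribed rank-one
  -- map, and these span all endomorphisms.
  obtain ⟨d, hd⟩ := Module.Projective.exists_dual_eq_one K hm
  have hrank : ∀ (f : Module.Dual K M) (w : M), f.smulRight w ∈ N := fun f w => by
    have h : f.smulRight w = d.smulRight w * n * f.smulRight m :=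
      LinearMap.ext fun z => by simp [hd]
    rw [h]
    exact hr _ (hR _) _ (hl _ (hR _) _ hn)
  refine (Submodule.eq_top_iff').2 fun g => ?_
  have hg : g = ∑ i, ((Module.finBasis K M).coord i).smulRight (g (Module.finBasis K M i)) :=
    (Module.finBasis K M).ext fun j => by simp [Finsupp.single_apply]
  rw [hg]
  exact sum_mem fun i _ => hrank _ _

namespace AssocSuperalgebra

/-! ### Faithful irreducible graded representations -/

section Representation

variable {K V : Type*} [Field K] [AddCommGroup V] [Module K V]

/-- A representation of a superalgebra on the space `M`, graded by the involution `inv`. -/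
structure GradedRep (T : AssocSuperalgebra K V) (M : Type*) [AddCommGroup M] [Module K M] where
  act : V →ₗ[K] Module.End K M
  inv : Module.End K M
  act_mul : ∀ a b, act (T.mul a b) = act a * act b
  inv_inv : inv * inv = 1
  inv_act : ∀ a, inv * act a = act (T.parity a) * inv

namespace GradedRep

variable {T : AssocSuperalgebra K V} {M : Type*} [AddCommGroup M] [Module K M]

/-- The representation has no graded subrepresentation other than `0` and the whole space. -/
def IsIrreducible (ρ : GradedRep T M) : Prop :=
  ∀ P : Submodule K M, (∀ a, ∀ x ∈ P, ρ.act a x ∈ P) → (∀ x ∈ P, ρ.inv x ∈ P) → P = ⊥ ∨ P = ⊤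

/-- The same representation with the parity of the space reversed. -/
def reverse (ρ : GradedRep T M) : GradedRep T M where
  act := ρ.act
  inv := -ρ.inv
  act_mul := ρ.act_mul
  inv_inv := by simp [ρ.inv_inv]
  inv_act a := by simp [ρ.inv_act]

theorem inv_inv_apply (ρ : GradedRep T M) (x : M) : ρ.inv (ρ.inv x) = x :=
  LinearMap.congr_fun ρ.inv_inv x

theorem inv_act_apply (ρ : GradedRep T M) (a : V) (x : M) :
    ρ.inv (ρ.act a x) = ρ.act (T.parity a) (ρ.inv x) :=
  LinearMap.congr_fun (ρ.inv_act a) x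

end GradedRep

/-- A simple superalgebra acts faithfully on each of its nonzero graded left ideals. -/
theorem IsSimple.eq_zero_of_mul_eq_zero [CharZero K] {T : AssocSuperalgebra K V} (hT : T.IsSimple)
    {L : Submodule K V} (hL : ∀ a, ∀ x ∈ L, T.mul a x ∈ L) (hpar : ∀ x ∈ L, T.parity x ∈ L)
    (hne : L ≠ ⊥) {a : V} (ha : ∀ x ∈ L, T.mul a x = 0) : a = 0 := by
  -- Otherwise `L` lies in the graded ideal of all `x` with `Vx = 0`, which is then nonzero, hence
  -- all of `V`, and the product is null.
  have hr : ∃ x ∈ L, ∃ a, T.mul a x ≠ 0 := by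
    by_contra! h
    let I : Submodule K V := LinearMap.ker T.mul.flip
    have hI : ∀ x, x ∈ I ↔ ∀ a, T.mul a x = 0 := fun x => by
      simp [I, LinearMap.ext_iff]
    have hIg : T.IsGradedIdeal I := by
      rw [isGradedIdeal_iff]
      simp only [hI]
      refine ⟨fun a x hx b => by rw [hx, map_zero], fun x a hx b => by
        rw [← T.mul_assoc, hx]; simp, fun x hx a => ?_⟩
      rw [← T.parity_parity a, ← parity_mul, hx, map_zero]
    obtain h0 | h0 := hT.2 I hIg
    · exact hne (eq_bot_iff.2 fun x hx => h0 ▸ (hI x).2 (h x hx))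
    · obtain ⟨x, y, hxy⟩ := hT.1
      exact hxy ((hI y).1 (h0 ▸ Submodule.mem_top) x)
  -- The left annihilator of `L` is two-sided because `L` is a left ideal. It is not `V` by `hr`, so
  -- it is `0`.
  let I : Submodule K V := ⨅ x : L, LinearMap.ker (T.mul.flip x)
  have hI : ∀ a, a ∈ I ↔ ∀ x ∈ L, T.mul a x = 0 := fun a => by
    simp [I, Submodule.mem_iInf]
  have hIg : T.IsGradedIdeal I := by
    rw [isGradedIdeal_iff]
    simp only [hI]
    refine ⟨fun a b hb x hx => by rw [T.mul_assoc, hb x hx, map_zero],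
      fun b a hb x hx => by rw [T.mul_assoc, hb _ (hL a x hx)], fun a ha x hx => ?_⟩
    rw [← T.parity_parity x, ← parity_mul, ha _ (hpar x hx), map_zero]
  obtain h0 | h0 := hT.2 I hIg
  · exact (Submodule.mem_bot K).1 (h0 ▸ (hI a).2 ha)
  · obtain ⟨x, hx, b, hb⟩ := hr
    exact (hb ((hI b).1 (h0 ▸ Submodule.mem_top) x hx)).elim

/-- A simple superalgebra has a faithful irreducible graded representation. -/
theorem IsSimple.exists_gradedRep [CharZero K] [FiniteDimensional K V]
    {T : AssocSuperalgebra K V} (hT : T.IsSimple) :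
    ∃ (L : Submodule K V) (ρ : GradedRep T L), Nontrivial L ∧ ρ.IsIrreducible ∧
      Function.Injective ρ.act := by
  let C : Set (Submodule K V) :=
    {L | L ≠ ⊥ ∧ (∀ a, ∀ x ∈ L, T.mul a x ∈ L) ∧ ∀ x ∈ L, T.parity x ∈ L}
  have hC : C.Nonempty := ⟨⊤, by
    obtain ⟨x, y, hxy⟩ := hT.1
    intro h
    have : T.mul x y ∈ (⊥ : Submodule K V) := h ▸ Submodule.mem_top
    exact hxy this, by simp, by simp⟩
  obtain ⟨L, ⟨hL0, hL, hpar⟩, hmin⟩ := WellFounded.has_min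
    (wellFounded_lt : WellFounded ((· < ·) : Submodule K V → _ → Prop)) C hC
  let act : V →ₗ[K] Module.End K L :=
    { toFun := fun a => (T.mul a).restrict (hL a)
      map_add' := fun a b => LinearMap.ext fun x => Subtype.ext (by simp)
      map_smul' := fun c a => LinearMap.ext fun x => Subtype.ext (by simp) }
  have hact : ∀ a x, (act a x : V) = T.mul a x := fun _ _ => rfl
  have hinv : ∀ x, (T.parity.restrict hpar x : V) = T.parity x := fun _ => rfl
  let ρ : GradedRep T L :=
    { act := act
      inv := T.parity.restrict hpar
      act_mul := fun a b => LinearMap.ext fun x => Subtype.ext (T.mul_assoc a b x)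
      inv_inv := LinearMap.ext fun x => Subtype.ext (T.parity_parity x)
      inv_act := fun a => LinearMap.ext fun x => Subtype.ext (T.parity_mul a x) }
  refine ⟨L, ρ, (Submodule.nontrivial_iff_ne_bot).2 hL0, fun P hP hPi => ?_, ?_⟩
  -- A proper nonzero graded subrepresentation would be a smaller nonzero graded left ideal.
  · by_contra! h
    refine hmin (P.map L.subtype) ⟨?_, ?_, ?_⟩ (lt_of_le_of_ne (Submodule.map_subtype_le L P) ?_)
    · intro e
      exact h.1 (Submodule.map_injective_of_injective L.injective_subtype
        (e.trans (Submodule.map_bot _).symm))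
    · rintro a _ ⟨x, hx, rfl⟩
      exact ⟨act a x, hP a x hx, rfl⟩
    · rintro _ ⟨x, hx, rfl⟩
      exact ⟨_, hPi x hx, rfl⟩
    · intro e
      refine h.2 (Submodule.eq_top_iff'.2 fun x => ?_)
      have : (x : V) ∈ P.map L.subtype := e.symm.le x.2
      obtain ⟨y, hy, hyx⟩ := this
      rwa [← Subtype.ext hyx]
  · rw [← LinearMap.ker_eq_bot, LinearMap.ker_eq_bot']
    intro a ha
    exact hT.eq_zero_of_mul_eq_zero hL hpar hL0 fun x hx =>
      congrArg Subtype.val (LinearMap.congr_fun ha ⟨x, hx⟩)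

namespace GradedRep

variable {T : AssocSuperalgebra K V} {M : Type*} [AddCommGroup M] [Module K M]

/-- In a faithful irreducible graded representation every endomorphism is the sum of the action
of an element and the composition of such an action with the grading involution. -/
theorem exists_act_add [IsAlgClosed K] [FiniteDimensional K M] [Nontrivial V]
    (ρ : GradedRep T M) (hirr : ρ.IsIrreducible) (hinj : Function.Injective ρ.act)
    (g : Module.End K M) : ∃ a b, ρ.act a + ρ.act b * ρ.inv = g := by
  let N : Submodule K (Module.End K M) :=
    LinearMap.range (ρ.act.coprod (LinearMap.mulRight K ρ.inv ∘ₗ ρ.act))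
  have hN : ∀ g, g ∈ N ↔ ∃ a b, ρ.act a + ρ.act b * ρ.inv = g := fun g => by
    simp [N, LinearMap.mem_range]
  rw [← hN, Module.End.eq_top_of_irreducible N]
  · trivial
  · intro x hx y hy
    rw [hN] at hx hy ⊢
    obtain ⟨a, b, rfl⟩ := hx
    obtain ⟨c, d, rfl⟩ := hy
    -- Moving the involution past an action applies the parity operator to the acting element.
    refine ⟨T.mul a c + T.mul b (T.parity d), T.mul a d + T.mul b (T.parity c), ?_⟩
    have h1 : ρ.act b * ρ.inv * ρ.act c = ρ.act (T.mul b (T.parity c)) * ρ.inv := by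
      rw [_root_.mul_assoc, inv_act, act_mul, _root_.mul_assoc]
    have h2 : ρ.act b * ρ.inv * (ρ.act d * ρ.inv) = ρ.act (T.mul b (T.parity d)) := by
      rw [← _root_.mul_assoc, _root_.mul_assoc (ρ.act b), inv_act, act_mul, _root_.mul_assoc,
        _root_.mul_assoc, inv_inv, mul_one]
    rw [mul_add, add_mul, add_mul, h1, h2, map_add, map_add, act_mul ρ a c, act_mul ρ a d]
    noncomm_ring
  · intro h
    obtain ⟨a, ha⟩ := exists_ne (0 : V)
    have : ρ.act a ∈ N := (hN _).2 ⟨a, 0, by simp⟩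
    rw [h, Submodule.mem_bot] at this
    exact ha (hinj (by rw [this, map_zero]))
  · intro P hP
    have hPa : ∀ a, ∀ x ∈ P, ρ.act a x ∈ P := fun a x hx => hP _ ((hN _).2 ⟨a, 0, by simp⟩) x hx
    have hPi : ∀ a, ∀ x ∈ P, ρ.act a (ρ.inv x) ∈ P := fun a x hx =>
      hP (ρ.act a * ρ.inv) ((hN _).2 ⟨0, a, by simp⟩) x hx
    -- An `N`-stable `P` need not be graded, but its sum with its image under the involution is, and
    -- all actions send that sum into `P`.
    obtain h | h := hirr (P ⊔ P.map ρ.inv)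
      (fun a x hx => by
        obtain ⟨y, hy, _, ⟨z, hz, rfl⟩, rfl⟩ := Submodule.mem_sup.1 hx
        rw [map_add]
        exact Submodule.mem_sup_left (add_mem (hPa a y hy) (hPi a z hz)))
      (fun x hx => by
        obtain ⟨y, hy, _, ⟨z, hz, rfl⟩, rfl⟩ := Submodule.mem_sup.1 hx
        rw [map_add, inv_inv_apply]
        exact add_mem (Submodule.mem_sup_right ⟨y, hy, rfl⟩) (Submodule.mem_sup_left hz))
    · exact Or.inl (eq_bot_iff.2 (h ▸ le_sup_left))
    · right
      have hall : ∀ a x, ρ.act a x ∈ P := fun a x => by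
        obtain ⟨y, hy, _, ⟨z, hz, rfl⟩, rfl⟩ :=
          Submodule.mem_sup.1 (h ▸ Submodule.mem_top : x ∈ P ⊔ P.map ρ.inv)
        rw [map_add]
        exact add_mem (hPa a y hy) (hPi a z hz)
      -- The span of all values of the action is graded, nonzero by faithfulness, and contained in
      -- `P`; irreducibility makes it the whole space.
      let Q : Submodule K M := Submodule.span K {y | ∃ a x, ρ.act a x = y}
      have hQP : Q ≤ P := Submodule.span_le.2 (by rintro _ ⟨a, x, rfl⟩; exact hall a x)
      have hQ : ∀ a x, ρ.act a x ∈ Q := fun a x => Submodule.subset_span ⟨a, x, rfl⟩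
      obtain h' | h' := hirr Q (fun a x _ => hQ a x) fun x hx => by
        have hle : Q ≤ Q.comap ρ.inv := Submodule.span_le.2 (by
          rintro _ ⟨a, x, rfl⟩
          rw [SetLike.mem_coe, Submodule.mem_comap, inv_act_apply]
          exact hQ _ _)
        exact hle hx
      · obtain ⟨a, ha⟩ := exists_ne (0 : V)
        refine (ha (hinj ?_)).elim
        rw [map_zero]
        refine LinearMap.ext fun x => ?_
        simpa [h'] using hQ a x
      · exact eq_top_iff.2 (h' ▸ hQP)

/-- In a faithful irreducible graded representation of a simple superalgebra, either every
endomorphism is an action, or an action composed with the grading involution is never a nonzero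
action. -/
theorem surjective_or_disjoint [IsAlgClosed K] [CharZero K] [FiniteDimensional K M]
    [Nontrivial V] (hT : T.IsSimple) (ρ : GradedRep T M) (hirr : ρ.IsIrreducible)
    (hinj : Function.Injective ρ.act) :
    Function.Surjective ρ.act ∨ ∀ a b, ρ.act a = ρ.act b * ρ.inv → a = 0 := by
  let I : Submodule K V :=
    (LinearMap.range (LinearMap.mulRight K ρ.inv ∘ₗ ρ.act)).comap ρ.act
  have hI : ∀ a, a ∈ I ↔ ∃ b, ρ.act b * ρ.inv = ρ.act a := fun a => by
    simp [I]
  have hIg : T.IsGradedIdeal I := by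
    rw [isGradedIdeal_iff]
    simp only [hI]
    refine ⟨?_, ?_, ?_⟩
    · rintro a x ⟨b, hb⟩
      exact ⟨T.mul a b, by rw [act_mul, act_mul, _root_.mul_assoc, hb]⟩
    · rintro x a ⟨b, hb⟩
      exact ⟨T.mul b (T.parity a), by
        rw [act_mul, act_mul, _root_.mul_assoc, ← inv_act, ← _root_.mul_assoc, hb]⟩
    · rintro x ⟨b, hb⟩
      refine ⟨T.parity b, ?_⟩
      have h := congrArg (fun g => ρ.inv * g * ρ.inv) hb
      simp only [inv_act, ← _root_.mul_assoc] at h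
      simpa only [_root_.mul_assoc, inv_inv, mul_one] using h
  obtain h | h := hT.2 I hIg
  · right
    intro a b hab
    exact (Submodule.mem_bot K).1 (h ▸ (hI a).2 ⟨b, hab.symm⟩)
  · left
    intro g
    obtain ⟨a, b, rfl⟩ := ρ.exists_act_add hirr hinj g
    obtain ⟨c, hc⟩ := (hI b).1 (h ▸ Submodule.mem_top)
    refine ⟨a + c, ?_⟩
    rw [← hc, _root_.mul_assoc, inv_inv, mul_one, map_add]

end GradedRep

end Representation

/-! ### Wall's classification of simple superalgebras -/

section Wall

variable {K V : Type*} [Field K] [AddCommGroup V] [Module K V]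

/-- A linear bijection that preserves the product and the grading of superalgebras. -/
structure IsSuperIso {V' : Type*} [AddCommGroup V'] [Module K V']
    (T : AssocSuperalgebra K V) (T' : AssocSuperalgebra K V') (e : V ≃ₗ[K] V') : Prop where
  map_mul : ∀ x y, e (T.mul x y) = T'.mul (e x) (e y)
  map_parity : ∀ x, e (T.parity x) = T'.parity (e x)

namespace GradedRep

variable {T : AssocSuperalgebra K V} {M : Type*} [AddCommGroup M] [Module K M]

/-- A basis of the representation space that consists of eigenvectors of the involution. -/
def IsHomogeneousBasis {r s : ℕ} (ρ : GradedRep T M)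
    (b : Module.Basis (Fin r ⊕ Fin s) K M) : Prop :=
  ∀ p, ρ.inv (b p) = (-1 : K) ^ (indexParity p).val • b p

theorem IsHomogeneousBasis.repr_inv {r s : ℕ} {ρ : GradedRep T M}
    {b : Module.Basis (Fin r ⊕ Fin s) K M} (hb : ρ.IsHomogeneousBasis b) (p : Fin r ⊕ Fin s)
    (x : M) : b.repr (ρ.inv x) p = (-1 : K) ^ (indexParity p).val * b.repr x p := by
  have h : b.coord p ∘ₗ ρ.inv = (-1 : K) ^ (indexParity p).val • b.coord p :=
    b.ext fun q => by
      obtain rfl | hpq := eq_or_ne p q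
      · simp [hb p]
      · simp [hb q, hpq.symm]
  exact LinearMap.congr_fun h x

/-- Commuting the involution past a homogeneous action compares two signs; where the index parities
do not match the degree, the entry equals its own negative. -/
theorem IsHomogeneousBasis.toMatrix_mem [CharZero K] {r s : ℕ} {ρ : GradedRep T M}
    {b : Module.Basis (Fin r ⊕ Fin s) K M} (hb : ρ.IsHomogeneousBasis b) {i : ZMod 2} {v : V}
    (hv : v ∈ T.grade i) :
    LinearMap.toMatrixAlgEquiv b (ρ.act v) ∈ (matrixSuperalgebra K r s).grade i := by
  intro p q hpq
  have h := hb.repr_inv p (ρ.act v (b q))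
  rw [inv_act_apply, (T.mem_grade_iff i v).1 hv, hb q] at h
  simp only [map_smul, LinearMap.smul_apply, Finsupp.smul_apply, smul_eq_mul] at h
  rw [LinearMap.toMatrixAlgEquiv_apply]
  generalize b.repr (ρ.act v (b q)) p = z at h ⊢
  generalize indexParity p = k at h hpq
  generalize indexParity q = l at h hpq
  have h01 : ∀ i : ZMod 2, i = 0 ∨ i = 1 := by decide
  obtain rfl | rfl := h01 i <;> obtain rfl | rfl := h01 k <;> obtain rfl | rfl := h01 l <;>
    first
    | exact absurd (by decide) hpq
    | (simp only [ZMod.val_zero, ZMod.val_one, pow_zero, pow_one] at h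
       exact (mul_eq_zero.1 (by linear_combination h : (2 : K) * z = 0)).resolve_left two_ne_zero)
    | (simp only [ZMod.val_zero, ZMod.val_one, pow_zero, pow_one] at h
       exact (mul_eq_zero.1 (by linear_combination -h : (2 : K) * z = 0)).resolve_left two_ne_zero)

variable [CharZero K]

/-- The representation space as a superalgebra with null product. -/
def nullSuperalgebra (ρ : GradedRep T M) : AssocSuperalgebra K M :=
  ofParity 0 (fun _ _ _ => rfl) ρ.inv ρ.inv_inv_apply fun _ _ => by simp

theorem mem_nullSuperalgebra_grade (ρ : GradedRep T M) (i : ZMod 2) (x : M) :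
    x ∈ ρ.nullSuperalgebra.grade i ↔ ρ.inv x = (-1 : K) ^ i.val • x := Iff.rfl

/-- The basis of the representation space assembled from bases of its even and odd parts. -/
noncomputable def joinBasis {r s : ℕ} (ρ : GradedRep T M)
    (b₀ : Module.Basis (Fin r) K (ρ.nullSuperalgebra.grade 0))
    (b₁ : Module.Basis (Fin s) K (ρ.nullSuperalgebra.grade 1)) :
    Module.Basis (Fin r ⊕ Fin s) K M :=
  (b₀.prod b₁).map (Submodule.prodEquivOfIsCompl _ _ ρ.nullSuperalgebra.isCompl)

theorem joinBasis_inl {r s : ℕ} (ρ : GradedRep T M)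
    (b₀ : Module.Basis (Fin r) K (ρ.nullSuperalgebra.grade 0))
    (b₁ : Module.Basis (Fin s) K (ρ.nullSuperalgebra.grade 1)) (i : Fin r) :
    ρ.joinBasis b₀ b₁ (Sum.inl i) = b₀ i := by
  simp [joinBasis]

theorem joinBasis_inr {r s : ℕ} (ρ : GradedRep T M)
    (b₀ : Module.Basis (Fin r) K (ρ.nullSuperalgebra.grade 0))
    (b₁ : Module.Basis (Fin s) K (ρ.nullSuperalgebra.grade 1)) (i : Fin s) :
    ρ.joinBasis b₀ b₁ (Sum.inr i) = b₁ i := by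
  simp [joinBasis]

theorem isHomogeneousBasis_joinBasis {r s : ℕ} (ρ : GradedRep T M)
    (b₀ : Module.Basis (Fin r) K (ρ.nullSuperalgebra.grade 0))
    (b₁ : Module.Basis (Fin s) K (ρ.nullSuperalgebra.grade 1)) :
    ρ.IsHomogeneousBasis (ρ.joinBasis b₀ b₁) := by
  rintro (i | i)
  · rw [joinBasis_inl]
    exact (ρ.mem_nullSuperalgebra_grade 0 _).1 (b₀ i).2
  · rw [joinBasis_inr]
    exact (ρ.mem_nullSuperalgebra_grade 1 _).1 (b₁ i).2

theorem exists_superIso_matrix_of_even [FiniteDimensional K M] (ρ : GradedRep T M)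
    (hinj : Function.Injective ρ.act) (hsurj : Function.Surjective ρ.act)
    (h0 : ∃ x, x ≠ 0 ∧ ρ.inv x = x) :
    ∃ r s : ℕ, 1 ≤ r ∧ ∃ e, IsSuperIso T (matrixSuperalgebra K r s) e := by
  let b := ρ.joinBasis (Module.finBasis K _) (Module.finBasis K _)
  have hb : ρ.IsHomogeneousBasis b := ρ.isHomogeneousBasis_joinBasis _ _
  refine ⟨_, _, ?_, (LinearEquiv.ofBijective ρ.act ⟨hinj, hsurj⟩).trans
    (LinearMap.toMatrixAlgEquiv b).toLinearEquiv, ⟨fun x y => ?_, fun x => ?_⟩⟩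
  · obtain ⟨x, hx, hx'⟩ := h0
    rw [Nat.one_le_iff_ne_zero, Ne, Submodule.finrank_eq_zero]
    intro h
    refine hx ((Submodule.mem_bot K).1 (h ▸ ?_))
    rw [mem_nullSuperalgebra_grade, hx']
    simp
  · change LinearMap.toMatrixAlgEquiv b (ρ.act (T.mul x y)) =
      LinearMap.toMatrixAlgEquiv b (ρ.act x) * LinearMap.toMatrixAlgEquiv b (ρ.act y)
    rw [act_mul, map_mul]
  · exact map_parity (f := (LinearMap.toMatrixAlgEquiv b).toLinearMap ∘ₗ ρ.act)
      (fun i x hx => hb.toMatrix_mem hx) x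

/-- A superalgebra that acts faithfully and by all endomorphisms is a matrix superalgebra. -/
theorem exists_superIso_matrix [FiniteDimensional K M] [Nontrivial M] (ρ : GradedRep T M)
    (hinj : Function.Injective ρ.act) (hsurj : Function.Surjective ρ.act) :
    ∃ r s : ℕ, 1 ≤ r ∧ ∃ e, IsSuperIso T (matrixSuperalgebra K r s) e := by
  obtain ⟨m, hm⟩ := exists_ne (0 : M)
  -- The vector `m + ρ.inv m` is even. If it vanishes then `m` is odd, and reversing the parity of
  -- the space provides an even vector, as `1 ≤ r` requires.
  by_cases h : m + ρ.inv m = 0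
  · refine ρ.reverse.exists_superIso_matrix_of_even hinj hsurj ⟨m, hm, ?_⟩
    change -(ρ.inv m) = m
    exact (eq_neg_of_add_eq_zero_left h).symm
  · refine ρ.exists_superIso_matrix_of_even hinj hsurj ⟨_, h, ?_⟩
    rw [map_add, inv_inv_apply, add_comm]

/-- A superalgebra that acts faithfully as the centralizer of an odd involution is a queer
superalgebra. -/
theorem exists_superIso_queer [FiniteDimensional K M] [Nontrivial M] (ρ : GradedRep T M)
    (hinj : Function.Injective ρ.act) (u : Module.End K M) (hu : u * u = 1)
    (hodd : u * ρ.inv = -(ρ.inv * u)) (hcent : ∀ g, (∃ a, ρ.act a = g) ↔ u * g = g * u) :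
    ∃ n : ℕ, 1 ≤ n ∧ ∃ e, IsSuperIso T (queerSuperalgebra K n) e := by
  have hu' : ∀ x, u (u x) = x := fun x => LinearMap.congr_fun hu x
  have hodd' : ∀ x, ρ.inv (u x) = -u (ρ.inv x) := fun x => by
    rw [eq_neg_iff_add_eq_zero, add_comm, ← eq_neg_iff_add_eq_zero]
    exact LinearMap.congr_fun hodd x
  have h01 : ∀ x ∈ ρ.nullSuperalgebra.grade 0, u x ∈ ρ.nullSuperalgebra.grade 1 := fun x hx => by
    rw [mem_nullSuperalgebra_grade] at hx ⊢
    simp [hodd', hx, ZMod.val_one]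
  have h10 : ∀ x ∈ ρ.nullSuperalgebra.grade 1, u x ∈ ρ.nullSuperalgebra.grade 0 := fun x hx => by
    rw [mem_nullSuperalgebra_grade] at hx ⊢
    simp [hodd', hx, ZMod.val_one]
  -- The odd involution `u` exchanges the two homogeneous parts. Transporting a basis of the even
  -- part by `u` makes `u` the exchange of the two blocks, whose centralizer is the queer algebra.
  let eu : ρ.nullSuperalgebra.grade 0 ≃ₗ[K] ρ.nullSuperalgebra.grade 1 :=
    LinearEquiv.ofLinearMap (u.restrict h01) (u.restrict h10)
      (LinearMap.ext fun x => Subtype.ext (hu' x)) (LinearMap.ext fun x => Subtype.ext (hu' x))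
  let b₀ := Module.finBasis K (ρ.nullSuperalgebra.grade 0)
  let b := ρ.joinBasis b₀ (b₀.map eu)
  have hb : ρ.IsHomogeneousBasis b := ρ.isHomogeneousBasis_joinBasis _ _
  have hl : ∀ i, b (Sum.inl i) = b₀ i := fun i => ρ.joinBasis_inl _ _ i
  have hr : ∀ i, b (Sum.inr i) = u (b₀ i) := fun i => by
    rw [ρ.joinBasis_inr, Module.Basis.map_apply]
    rfl
  have hub : ∀ p, u (b p) = b p.swap := by
    rintro (i | i)
    · rw [Sum.swap_inl, hl, hr]
    · rw [Sum.swap_inr, hl, hr, hu']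
  have hrepr : ∀ x p, b.repr (u x) p = b.repr x p.swap := fun x p => by
    have h : b.coord p ∘ₗ u = b.coord p.swap := b.ext fun q => by
      have : q.swap = p ↔ q = p.swap :=
        ⟨fun h => by rw [← h, Sum.swap_swap], fun h => by rw [h, Sum.swap_swap]⟩
      simp [hub, Finsupp.single_apply, this]
    exact LinearMap.congr_fun h x
  have hiff : ∀ g : Module.End K M, u * g = g * u ↔
      LinearMap.toMatrixAlgEquiv b g ∈ queerSubalgebra K _ := by
    intro g
    have key : u * g = g * u ↔
        ∀ p q, LinearMap.toMatrixAlgEquiv b g p.swap q = LinearMap.toMatrixAlgEquiv b g p q.swap := by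
      simp only [LinearMap.toMatrixAlgEquiv_apply]
      refine ⟨fun h p q => ?_, fun h => b.ext fun q => b.ext_elem fun p => ?_⟩
      · rw [← hrepr, ← hub]
        exact congrArg (fun y => b.repr y p) (LinearMap.congr_fun h (b q))
      · change b.repr (u (g (b q))) p = b.repr (g (u (b q))) p
        rw [hrepr, hub, h]
    rw [key]
    constructor
    · intro h
      refine ⟨(LinearMap.toMatrixAlgEquiv b g).toBlocks₁₁,
        (LinearMap.toMatrixAlgEquiv b g).toBlocks₁₂, ?_⟩
      ext (p | p) (q | q)
      · rfl
      · rfl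
      · exact h (Sum.inl p) (Sum.inl q)
      · exact h (Sum.inl p) (Sum.inr q)
    · rintro ⟨x, y, h⟩
      rw [h]
      rintro (p | p) (q | q) <;> rfl
  let f : V →ₗ[K] queerSubalgebra K (Module.finrank K (ρ.nullSuperalgebra.grade 0)) :=
    LinearMap.codRestrict (Subalgebra.toSubmodule (queerSubalgebra K _))
      ((LinearMap.toMatrixAlgEquiv b).toLinearMap ∘ₗ ρ.act)
      fun v => (hiff _).1 ((hcent _).1 ⟨v, rfl⟩)
  have hf : ∀ v, (f v : Matrix _ _ K) = LinearMap.toMatrixAlgEquiv b (ρ.act v) := fun _ => rfl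
  have hfb : Function.Bijective f := by
    refine ⟨fun v w h => hinj ((LinearMap.toMatrixAlgEquiv b).injective ?_), fun X => ?_⟩
    · rw [← hf, ← hf, h]
    · obtain ⟨v, hv⟩ := (hcent ((LinearMap.toMatrixAlgEquiv b).symm X)).2
        ((hiff _).2 (by rw [AlgEquiv.apply_symm_apply]; exact X.2))
      exact ⟨v, Subtype.ext (by rw [hf, hv, AlgEquiv.apply_symm_apply])⟩
  refine ⟨_, ?_, LinearEquiv.ofBijective f hfb, ⟨fun x y => Subtype.ext ?_, fun x => ?_⟩⟩
  · rw [Nat.one_le_iff_ne_zero]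
    intro h
    have : IsEmpty (Fin (Module.finrank K (ρ.nullSuperalgebra.grade 0)) ⊕
        Fin (Module.finrank K (ρ.nullSuperalgebra.grade 0))) := by
      rw [h]; infer_instance
    obtain ⟨m, hm⟩ := exists_ne (0 : M)
    exact hm (b.ext_elem fun p => this.elim p)
  · change LinearMap.toMatrixAlgEquiv b (ρ.act (T.mul x y)) =
      LinearMap.toMatrixAlgEquiv b (ρ.act x) * LinearMap.toMatrixAlgEquiv b (ρ.act y)
    rw [act_mul, map_mul]
  · exact map_parity (T := queerSuperalgebra K _) (f := f) (fun i x hx => hb.toMatrix_mem hx) x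

/-- If the actions and their compositions with the grading involution decompose the endomorphism
algebra, then the actions form the centralizer of an odd involution. -/
theorem exists_odd_involution [IsAlgClosed K] [FiniteDimensional K M] [Nontrivial M]
    (ρ : GradedRep T M)
    (hadd : ∀ g, ∃ a b, ρ.act a + ρ.act b * ρ.inv = g)
    (hdisj : ∀ a b, ρ.act a = ρ.act b * ρ.inv → a = 0) :
    ∃ u : Module.End K M, u * u = 1 ∧ u * ρ.inv = -(ρ.inv * u) ∧
      ∀ g, (∃ a, ρ.act a = g) ↔ u * g = g * u := by
  let C : ZMod 2 → Submodule K (Module.End K M) := fun i =>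
    if i = 0 then LinearMap.range ρ.act
    else LinearMap.range (LinearMap.mulRight K ρ.inv ∘ₗ ρ.act)
  have hC0 : ∀ g, g ∈ C 0 ↔ ∃ a, ρ.act a = g := fun g => by simp [C]
  have hC1 : ∀ g, g ∈ C 1 ↔ ∃ a, ρ.act a * ρ.inv = g := fun g => by simp [C]
  let E : AssocSuperalgebra K (Module.End K M) :=
    { mul := LinearMap.mul K _
      mul_assoc := fun x y z => _root_.mul_assoc x y z
      grade := C
      isCompl := by
        constructor
        · rw [Submodule.disjoint_def]
          intro g h0 h1
          rw [hC0] at h0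
          rw [hC1] at h1
          obtain ⟨a, rfl⟩ := h0
          obtain ⟨b, hb⟩ := h1
          rw [hdisj a b hb.symm, map_zero]
        · rw [codisjoint_iff, Submodule.eq_top_iff']
          intro g
          obtain ⟨a, b, h⟩ := hadd g
          exact Submodule.mem_sup.2 ⟨_, (hC0 _).2 ⟨a, rfl⟩, _, (hC1 _).2 ⟨b, rfl⟩, h⟩
      mul_mem := by
        intro i j x y hx hy
        have h01 : ∀ i : ZMod 2, i = 0 ∨ i = 1 := by decide
        have h11 : (1 : ZMod 2) + 1 = 0 := by decide
        rw [LinearMap.mul_apply']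
        obtain rfl | rfl := h01 i <;> obtain rfl | rfl := h01 j <;>
          simp only [add_zero, zero_add, h11, hC0, hC1] at hx hy ⊢ <;>
          obtain ⟨a, rfl⟩ := hx <;> obtain ⟨b, rfl⟩ := hy
        · exact ⟨_, ρ.act_mul a b⟩
        · exact ⟨T.mul a b, by rw [act_mul, _root_.mul_assoc]⟩
        · exact ⟨T.mul a (T.parity b), by
            rw [act_mul, _root_.mul_assoc, _root_.mul_assoc, ← inv_act]⟩
        · exact ⟨T.mul a (T.parity b), by
            rw [act_mul, ← _root_.mul_assoc, _root_.mul_assoc (ρ.act a), inv_act,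
              _root_.mul_assoc, _root_.mul_assoc, inv_inv, mul_one]⟩ }
  have hEmul : ∀ x y, E.parity (x * y) = E.parity x * E.parity y := E.parity_mul
  -- A surjective multiplicative map fixes the unit.
  have hE1 : E.parity 1 = 1 := by
    have h := hEmul 1 (E.parity 1)
    rwa [one_mul, parity_parity, mul_one, eq_comm] at h
  let τ : Module.End K M ≃ₐ[K] Module.End K M :=
    AlgEquiv.ofLinearEquiv (LinearEquiv.ofInvolutive E.parity E.parity_parity) hE1 hEmul
  -- Skolem–Noether: the grading automorphism is conjugation by `t`. As it is an involution, `t²` is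
  -- central, hence a scalar, and dividing `t` by a square root of that scalar normalizes it.
  obtain ⟨t, ht⟩ := τ.eq_linearEquivConjAlgEquiv
  have hconj : ∀ g, E.parity g * (t : Module.End K M) = (t : Module.End K M) * g := fun g => by
    have h : E.parity g = t.conjAlgEquiv K g := congrArg (fun F => F g) ht
    rw [h]
    refine LinearMap.ext fun x => ?_
    simp [LinearEquiv.conjAlgEquiv_apply]
  have hcen : (t : Module.End K M) * t ∈ Subalgebra.center K (Module.End K M) := by
    rw [Subalgebra.mem_center_iff]
    intro g
    rw [← _root_.mul_assoc, ← E.parity_parity g, hconj, E.parity_parity, _root_.mul_assoc, hconj,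
      _root_.mul_assoc]
  rw [Algebra.IsCentral.center_eq_bot, Algebra.mem_bot] at hcen
  obtain ⟨c, hc⟩ := hcen
  have hc0 : c ≠ 0 := by
    rintro rfl
    obtain ⟨m, hm⟩ := exists_ne (0 : M)
    have h := LinearMap.congr_fun hc m
    rw [map_zero, LinearMap.zero_apply] at h
    change 0 = t (t m) at h
    exact hm (by simpa using h.symm)
  obtain ⟨k, rfl⟩ := IsAlgClosed.exists_eq_mul_self c
  have hk : k ≠ 0 := fun h => hc0 (by rw [h, mul_zero])
  have hu : ∀ g, (k⁻¹ • (t : Module.End K M)) * g = E.parity g * (k⁻¹ • (t : Module.End K M)) :=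
    fun g => by rw [smul_mul_assoc, mul_smul_comm, hconj]
  have huu : (k⁻¹ • (t : Module.End K M)) * (k⁻¹ • (t : Module.End K M)) = 1 := by
    rw [smul_mul_smul_comm, ← hc, Algebra.algebraMap_eq_smul_one, smul_smul]
    have : k⁻¹ * k⁻¹ * (k * k) = 1 := by field_simp
    rw [this, one_smul]
  refine ⟨k⁻¹ • (t : Module.End K M), huu, ?_, fun g => ?_⟩
  -- The identity is even, hence an action; so `ρ.inv` lies in the odd part and conjugation by `u`
  -- negates it.
  · obtain ⟨a, ha⟩ := (hC0 1).1 ((E.mem_grade_iff 0 1).2 (by simp [hE1]))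
    have : ρ.inv ∈ E.grade 1 := (hC1 _).2 ⟨a, by rw [ha, one_mul]⟩
    rw [hu, E.parity_of_mem_one this, neg_mul]
  -- Commuting with `u` means being fixed by the parity of `E`, that is, lying in its even part, the
  -- space of actions.
  · rw [← hC0, hu]
    refine (E.mem_grade_iff 0 g).trans ⟨fun h => ?_, fun h => ?_⟩
    · rw [h]; simp
    · have h' := congrArg (· * (k⁻¹ • (t : Module.End K M))) h
      simp only [_root_.mul_assoc, huu, mul_one] at h'
      simpa using h'

end GradedRep

/-- Wall's theorem: a finite-dimensional simple superalgebra over an algebraically closed field of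
characteristic zero is a matrix superalgebra or a queer superalgebra. -/
theorem IsSimple.exists_superIso [IsAlgClosed K] [CharZero K] [FiniteDimensional K V]
    {T : AssocSuperalgebra K V} (hT : T.IsSimple) :
    (∃ r s : ℕ, 1 ≤ r ∧ ∃ e, IsSuperIso T (matrixSuperalgebra K r s) e) ∨
      ∃ n : ℕ, 1 ≤ n ∧ ∃ e, IsSuperIso T (queerSuperalgebra K n) e := by
  have : Nontrivial V := by
    obtain ⟨x, y, h⟩ := hT.1
    exact ⟨⟨_, _, h⟩⟩
  obtain ⟨L, ρ, hL, hirr, hinj⟩ := hT.exists_gradedRep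
  obtain h | h := ρ.surjective_or_disjoint hT hirr hinj
  · exact Or.inl (ρ.exists_superIso_matrix hinj h)
  · obtain ⟨u, hu, hodd, hcent⟩ := ρ.exists_odd_involution (ρ.exists_act_add hirr hinj) h
    exact Or.inr (ρ.exists_superIso_queer hinj u hu hodd hcent)

end Wall

/-! ### Maximal graded ideals and their quotients -/

section Irreducible

variable {K A : Type*} [Field K] [AddCommGroup A] [Module K A]

theorem exists_homogeneous_ne_zero [Nontrivial A] (S : AssocSuperalgebra K A) :
    ∃ i, ∃ x ∈ S.grade i, x ≠ 0 := by
  obtain ⟨x, hx⟩ := exists_ne (0 : A)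
  obtain ⟨x₀, h₀, x₁, h₁, rfl⟩ := S.exists_add x
  by_cases h : x₀ = 0
  · exact ⟨1, x₁, h₁, fun h' => hx (by rw [h, h', add_zero])⟩
  · exact ⟨0, x₀, h₀, h⟩

/-- In a nonzero superalgebra with null product and no proper nonzero graded ideal, some
homogeneous vector spans the space. -/
theorem exists_span_eq_top [CharZero K] [Nontrivial A] (S : AssocSuperalgebra K A)
    (hnull : ∀ x y, S.mul x y = 0)
    (hsimple : ∀ I : Submodule K A, S.IsGradedIdeal I → I = ⊥ ∨ I = ⊤) :
    ∃ i, ∃ x ∈ S.grade i, x ≠ 0 ∧ Submodule.span K {x} = ⊤ := by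
  obtain ⟨i, x, hx, hx0⟩ := S.exists_homogeneous_ne_zero
  refine ⟨i, x, hx, hx0, (hsimple _ ?_).resolve_left ?_⟩
  · rw [isGradedIdeal_iff]
    simp only [hnull]
    refine ⟨fun _ _ _ => zero_mem _, fun _ _ _ => zero_mem _, fun y hy => ?_⟩
    obtain ⟨c, rfl⟩ := Submodule.mem_span_singleton.1 hy
    rw [map_smul, (S.mem_grade_iff i x).1 hx]
    exact Submodule.smul_mem _ _ (Submodule.smul_mem _ _ (Submodule.mem_span_singleton_self x))
  · exact fun h => hx0 (Submodule.span_singleton_eq_bot.1 h)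

/-- A superalgebra with null product and no proper nonzero graded ideal is one-dimensional. -/
theorem exists_superIso_null [CharZero K] [Nontrivial A] (S : AssocSuperalgebra K A)
    (hnull : ∀ x y, S.mul x y = 0)
    (hsimple : ∀ I : Submodule K A, S.IsGradedIdeal I → I = ⊥ ∨ I = ⊤) :
    ∃ T : AssocSuperalgebra K K, (∀ x y, T.mul x y = 0) ∧ ∃ e, IsSuperIso S T e := by
  obtain ⟨i, x, hx, hx0, htop⟩ := S.exists_span_eq_top hnull hsimple
  have hi : (-1 : K) ^ i.val * (-1) ^ i.val = 1 := by
    rw [← mul_pow]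
    simp
  let e : K ≃ₗ[K] A := (LinearEquiv.toSpanNonzeroSingleton K A x hx0).trans
    ((LinearEquiv.ofEq _ _ htop).trans Submodule.topEquiv)
  have he : ∀ c, e c = c • x := fun _ => rfl
  let T : AssocSuperalgebra K K := ofParity 0 (fun _ _ _ => rfl)
    ((-1 : K) ^ i.val • LinearMap.id) (fun c => by simp [← _root_.mul_assoc, hi]) fun _ _ => by simp
  refine ⟨T, fun _ _ => rfl, e.symm, ⟨fun y z => ?_, fun y => ?_⟩⟩
  · rw [hnull, map_zero]
    rfl
  · obtain ⟨c, rfl⟩ := e.surjective y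
    rw [LinearEquiv.symm_apply_eq, LinearEquiv.symm_apply_apply]
    simp only [T, parity_ofParity, he]
    simp [(S.mem_grade_iff i x).1 hx, smul_smul, mul_comm]

/-- A non-simple irreducible odd-symmetric superalgebra has a maximal graded ideal that contains
its orthogonal. -/
theorem exists_maximal_gradedIdeal [CharZero K] [FiniteDimensional K A] [Nontrivial A]
    {S : AssocSuperalgebra K A} {B : LinearMap.BilinForm K A} (hB : S.IsOddSymmetric B)
    (hirr : S.IsBIrreducible B) (hns : ¬ S.IsSimple) :
    ∃ J : Submodule K A, S.IsGradedIdeal J ∧ J ≠ ⊤ ∧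
      (∀ I, S.IsGradedIdeal I → J ≤ I → I = J ∨ I = ⊤) ∧
      ∀ a, (∀ b ∈ J, B a b = 0) → a ∈ J := by
  have hbot : S.IsGradedIdeal ⊥ := by
    rw [isGradedIdeal_iff]
    simp +contextual
  obtain ⟨J, ⟨hJ, hJtop⟩, hmax⟩ := WellFounded.has_min
    (wellFounded_gt : WellFounded ((· > ·) : Submodule K A → _ → Prop))
    {I | S.IsGradedIdeal I ∧ I ≠ ⊤} ⟨⊥, hbot, bot_ne_top⟩
  have hmax' : ∀ I, S.IsGradedIdeal I → J ≤ I → I = J ∨ I = ⊤ := fun I hI hle => by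
    by_contra! h
    exact hmax I ⟨hI, h.2⟩ (lt_of_le_of_ne hle h.1.symm)
  refine ⟨J, hJ, hJtop, hmax', ?_⟩
  obtain ⟨hJl, hJr, hJp⟩ := (S.isGradedIdeal_iff J).1 hJ
  -- `O` is the orthogonal of `J`; invariance of `B` makes it an ideal and `parity_left` makes it
  -- graded.
  let O : Submodule K A := ⨅ b : J, LinearMap.ker (B.flip b)
  have hO : ∀ a, a ∈ O ↔ ∀ b ∈ J, B a b = 0 := fun a => by
    simp [O, Submodule.mem_iInf]
  have hOI : S.IsGradedIdeal (J ⊔ O) := by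
    have h : S.IsGradedIdeal O := by
      rw [isGradedIdeal_iff]
      simp only [hO]
      refine ⟨fun a x hx b hb => ?_, fun x a hx b hb => ?_, fun x hx b hb => ?_⟩
      · rw [hB.form_mul_left, hx _ (hJr b a hb)]
      · rw [hB.assoc, hx _ (hJl a b hb)]
      · rw [hB.parity_left, hx _ (hJp b hb), neg_zero]
    obtain ⟨hOl, hOr, hOp⟩ := (S.isGradedIdeal_iff O).1 h
    rw [isGradedIdeal_iff]
    refine ⟨fun a x hx => ?_, fun x a hx => ?_, fun x hx => ?_⟩ <;>
      obtain ⟨y, hy, z, hz, rfl⟩ := Submodule.mem_sup.1 hx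
    · rw [map_add]
      exact Submodule.add_mem_sup (hJl a y hy) (hOl a z hz)
    · rw [map_add, LinearMap.add_apply]
      exact Submodule.add_mem_sup (hJr y a hy) (hOr z a hz)
    · rw [map_add]
      exact Submodule.add_mem_sup (hJp y hy) (hOp z hz)
  obtain h | h := hmax' _ hOI le_sup_left
  · exact fun a ha => h ▸ Submodule.mem_sup_right ((hO a).2 ha)
  -- If `J + J^⊥ = A`, an element of `J` orthogonal to `J` is orthogonal to all of `A`.
  · have hdisj : ∀ x : J, (∀ y : J, B x y = 0) → x = 0 := fun x hx =>
      Subtype.ext (hB.nondegenerate.1 _ fun a => by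
        obtain ⟨y, hy, z, hz, rfl⟩ := Submodule.mem_sup.1 (h ▸ Submodule.mem_top : a ∈ J ⊔ O)
        rw [map_add, hx ⟨y, hy⟩, hB.symm, (hO z).1 hz _ x.2, add_zero])
    have hJ0 : J = ⊥ := (hirr J hJ ⟨fun x hx => hdisj x hx, fun x hx => hdisj x fun y => by
      rw [hB.symm]
      exact hx y⟩).resolve_right hJtop
    subst hJ0
    have hsimple : ∀ I : Submodule K A, S.IsGradedIdeal I → I = ⊥ ∨ I = ⊤ :=
      fun I hI => hmax' I hI bot_le
    have hnull : ∀ x y, S.mul x y = 0 := by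
      by_contra! h'
      exact hns ⟨h', hsimple⟩
    obtain ⟨i, x, hx, hx0, htop⟩ := S.exists_span_eq_top hnull hsimple
    refine (hx0 (hB.nondegenerate.1 x fun y => ?_)).elim
    obtain ⟨c, rfl⟩ := Submodule.mem_span_singleton.1 (htop ▸ Submodule.mem_top : y ∈ _)
    -- An odd form vanishes on two vectors of equal parity, so it is zero on a homogeneous line.
    rw [map_smul, hB.odd i i x x hx hx (by clear * -; revert i; decide), smul_zero]

/-- The quotient by a maximal graded ideal has no proper nonzero graded ideal. -/
theorem quotient_eq_bot_or_eq_top [CharZero K] {S : AssocSuperalgebra K A} {J : Submodule K A}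
    (hJ : S.IsGradedIdeal J) (hmax : ∀ I, S.IsGradedIdeal I → J ≤ I → I = J ∨ I = ⊤)
    (I : Submodule K (A ⧸ J)) (hI : (S.quotient J hJ).IsGradedIdeal I) : I = ⊥ ∨ I = ⊤ := by
  rw [isGradedIdeal_iff] at hI
  obtain ⟨hl, hr, hp⟩ := hI
  have hc : S.IsGradedIdeal (I.comap J.mkQ) := by
    rw [isGradedIdeal_iff]
    exact ⟨fun a x hx => hl (J.mkQ a) (J.mkQ x) hx, fun x a hx => hr (J.mkQ x) (J.mkQ a) hx,
      fun x hx => by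
        rw [Submodule.mem_comap, ← S.quotient_parity J hJ]
        exact hp _ hx⟩
  obtain h | h := hmax _ hc (fun x hx => by
    rw [Submodule.mem_comap, Submodule.mkQ_apply, (Submodule.Quotient.mk_eq_zero J).2 hx]
    exact zero_mem I)
  · left
    rw [← Submodule.map_comap_eq_of_surjective J.mkQ_surjective I, h, Submodule.mkQ_map_self]
  · right
    rw [← Submodule.map_comap_eq_of_surjective J.mkQ_surjective I, h, Submodule.map_top,
      Submodule.range_mkQ]

/-- A superalgebra isomorphic to the quotient by a graded ideal that contains its orthogonal gives
a generalized double extension. -/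
theorem isDoubleExtensionBy_of_quotient [CharZero K] [FiniteDimensional K A]
    {S : AssocSuperalgebra K A} {B : LinearMap.BilinForm K A} (hB : S.IsOddSymmetric B)
    {J : Submodule K A} (hJ : S.IsGradedIdeal J) (horth : ∀ a, (∀ b ∈ J, B a b = 0) → a ∈ J)
    {V : Type*} [AddCommGroup V] [Module K V] {T : AssocSuperalgebra K V}
    {e : (A ⧸ J) ≃ₗ[K] V} (he : IsSuperIso (S.quotient J hJ) T e) :
    S.IsDoubleExtensionBy B T := by
  have hker : ∀ a, e (J.mkQ a) = 0 ↔ a ∈ J := fun a => by simp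
  refine isDoubleExtensionBy_of_surjective hB (e.toLinearMap ∘ₗ J.mkQ)
    (e.surjective.comp J.mkQ_surjective) (fun a b => ?_) (fun a => ?_) fun a ha => ?_
  · exact he.map_mul (J.mkQ a) (J.mkQ b)
  · change e (J.mkQ (S.parity a)) = _
    rw [← S.quotient_parity J hJ, he.map_parity]
    rfl
  · exact (hker a).2 (horth a fun b hb => ha b ((hker b).2 hb))

end Irreducible

end AssocSuperalgebra

/-! ### The three cases for the quotient -/

theorem mainTheorem12 {K : Type*} [Field K] [IsAlgClosed K] [CharZero K]
    {A : Type*} [AddCommGroup A] [Module K A] [FiniteDimensional K A] [Nontrivial A]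
    (S : AssocSuperalgebra K A) (B : LinearMap.BilinForm K A)
    (hB : S.IsOddSymmetric B) (hirr : S.IsBIrreducible B) (hns : ¬ S.IsSimple) :
    (∃ r s : ℕ, 1 ≤ r ∧ S.IsDoubleExtensionBy B (AssocSuperalgebra.matrixSuperalgebra K r s)) ∨
    (∃ n : ℕ, 1 ≤ n ∧ S.IsDoubleExtensionBy B (AssocSuperalgebra.queerSuperalgebra K n)) ∨
    (∃ T : AssocSuperalgebra K K, (∀ x y, T.mul x y = 0) ∧ S.IsDoubleExtensionBy B T) := by
  obtain ⟨J, hJ, hJtop, hmax, horth⟩ := AssocSuperalgebra.exists_maximal_gradedIdeal hB hirr hns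
  have hsimple := AssocSuperalgebra.quotient_eq_bot_or_eq_top hJ hmax
  have : Nontrivial (A ⧸ J) := Submodule.Quotient.nontrivial_iff.2 hJtop
  by_cases hnull : ∀ x y, (S.quotient J hJ).mul x y = 0
  · obtain ⟨T, hT, e, he⟩ := (S.quotient J hJ).exists_superIso_null hnull hsimple
    exact Or.inr (Or.inr ⟨T, hT, AssocSuperalgebra.isDoubleExtensionBy_of_quotient hB hJ horth he⟩)
  · push Not at hnull
    have hT : (S.quotient J hJ).IsSimple := ⟨hnull, hsimple⟩
    obtain ⟨r, s, hr, e, he⟩ | ⟨n, hn, e, he⟩ := hT.exists_superIso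
    · exact Or.inl
        ⟨r, s, hr, AssocSuperalgebra.isDoubleExtensionBy_of_quotient hB hJ horth he⟩
    · exact Or.inr (Or.inl
        ⟨n, hn, AssocSuperalgebra.isDoubleExtensionBy_of_quotient hB hJ horth he⟩)
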